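/- Let $G$ be a finite simple graph with $|V(G)|\ge 6$ even. Write $\alpha(G)$ and $\omega(G)$ for the maximum sizes of an independent set and of a clique in $G$, and $\bar G$ for the complement of $G$. Suppose that $\alpha(G)\le 2$ and $\omega(G)<|V(G)|/4$, and put $n=|V(G)|/2$ and $k=\omega(G)$. Let $Z$ be a clique of $G$ with $|Z|=k$, and define $$a=\sum_{v\in Z}\deg_{\bar G}(v),\qquad b=|E(\bar G\setminus Z)|,$$ so that $b$ is the number of pairs of distinct non-adjacent vertices of $G$ that lie outside $Z$. Let $\lambda$ be a real number with $0<\lambda\le\frac{k-1}{2}$ and $\lambda^2>2n$, and let $$p=\frac{n-2k}{\,n-\frac{k+1}{2}-\frac{b}{2n-k-2}-\lambda\,}.$$ Then there is a (simple) minor $H$ of $G$ with $|V(H)|=n$ and $$\binom n2-|E(H)|\;\le\;\frac{1}{1-\frac{2n}{\lambda^2}}\left(\frac{b(k-1)^2p^2}{4(2n-k-2)(2n-k-4)}+\frac{a(k-1)p}{2(2n-k-2)}\right).$$ -/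

import Mathlib

/-- `H` is a minor of `G`: there are pairwise disjoint (nonempty) connected vertex sets `B w` of `G`,
one for each vertex `w` of `H`, such that adjacent vertices of `H` have an edge of `G` between
their sets. Equivalently, `H` arises from a subgraph of `G` by contracting edges. -/
def SimpleGraph.IsMinorOf {W V : Type*} (H : SimpleGraph W) (G : SimpleGraph V) : Prop :=
  ∃ B : W → Set V,
    (∀ w, (G.induce (B w)).Connected) ∧
    (∀ u w, u ≠ w → Disjoint (B u) (B w)) ∧
    (∀ u w, H.Adj u w → ∃ x ∈ B u, ∃ y ∈ B w, G.Adj x y)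

/-!
Let `K` be the complement of `G`: it is triangle-free, with degrees and independent sets of size at
most `k`. A *seagull* (an induced path of `G` on three vertices) has end points that are adjacent in
`K` and a middle point adjacent in `K` to neither. As `K` is triangle-free, every other vertex has a
neighbour in the seagull, so a contracted seagull is joined to all vertices of the minor.

Keep the clique `Z`, contract `n - 2k` matching edges of `G - Z`, and contract `k` seagulls that
partition the remaining `3k` vertices: this leaves `n` vertices. Such a partition always exists. In
a packing of seagulls of maximum size, local exchanges first force the uncovered vertices to be
independent in `K`, and then allow adding one vertex of each packed seagull to them, giving an
independent set of more than `k` vertices.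

Only two kinds of pairs can be missing: a vertex of `Z` with a matching edge inside its
`K`-neighbourhood (controlled by `a`), and two matching edges whose end points form a 4-cycle of `K`
(controlled by `b`). For a uniformly random matching of half the vertices outside `Z`, a second
moment estimate bounds the number of pairs that are not edges of `G`, and among those that are, a
random choice of a proportion `p` multiplies the two kinds of defects by `p` and `p ^ 2`.
-/

open Finset
open scoped BigOperators

/-! ### Packings of seagulls -/

section Coseagull

variable {V : Type*}

section Packing

variable [DecidableEq V] {K : SimpleGraph V} {R S : Finset V} {𝒮 𝒮' 𝒯 : Finset (Finset V)}

/-- A *coseagull* of `K` is a set of three vertices spanning exactly one edge of `K`, that is, a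
seagull (induced path on three vertices) of the complement of `K`. -/
def IsCoseagull (K : SimpleGraph V) (S : Finset V) : Prop :=
  ∃ x y z, K.Adj x y ∧ ¬K.Adj x z ∧ ¬K.Adj y z ∧ S = {x, y, z}

/-- `𝒯` is a packing of coseagulls of `K`: pairwise disjoint coseagulls contained in `R`. -/
structure IsPacking (K : SimpleGraph V) (R : Finset V) (𝒯 : Finset (Finset V)) : Prop where
  isCoseagull : ∀ T ∈ 𝒯, IsCoseagull K T
  subset : ∀ T ∈ 𝒯, T ⊆ R
  disjoint : ∀ S ∈ 𝒯, ∀ T ∈ 𝒯, S ≠ T → Disjoint S T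

/-- The part of `R` that the members of `𝒯` do not cover. -/
def uncovered (R : Finset V) (𝒯 : Finset (Finset V)) : Finset V :=
  R \ 𝒯.biUnion id

/-- A packing of coseagulls of maximum cardinality. -/
def IsMaxPacking (K : SimpleGraph V) (R : Finset V) (𝒯 : Finset (Finset V)) : Prop :=
  IsPacking K R 𝒯 ∧ ∀ 𝒯', IsPacking K R 𝒯' → #𝒯' ≤ #𝒯

lemma isCoseagull_triple {x y z : V} (hxy : K.Adj x y) (hxz : ¬K.Adj x z) (hyz : ¬K.Adj y z) :
    IsCoseagull K {x, y, z} :=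
  ⟨x, y, z, hxy, hxz, hyz, rfl⟩

lemma IsCoseagull.card_eq (h : IsCoseagull K S) : #S = 3 := by
  obtain ⟨x, y, z, hxy, hxz, hyz, rfl⟩ := h
  exact card_eq_three.2 ⟨x, y, z, hxy.ne, fun h => hyz (h ▸ hxy.symm), fun h => hxz (h ▸ hxy), rfl⟩

lemma IsCoseagull.nonempty (h : IsCoseagull K S) : S.Nonempty :=
  card_pos.1 (by simp [h.card_eq])

lemma mem_uncovered {x : V} : x ∈ uncovered R 𝒯 ↔ x ∈ R ∧ ∀ T ∈ 𝒯, x ∉ T := by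
  simp [uncovered]

lemma isPacking_empty : IsPacking K R ∅ :=
  ⟨by simp, by simp, by simp⟩

lemma isPacking_insert (hS : S ∉ 𝒯) : IsPacking K R (insert S 𝒯) ↔
    (IsCoseagull K S ∧ S ⊆ R ∧ ∀ T ∈ 𝒯, Disjoint S T) ∧ IsPacking K R 𝒯 := by
  refine ⟨fun h => ⟨⟨h.1 S (by simp), h.2 S (by simp), fun T hT => h.3 S (by simp) T (by simp [hT])
    (by grind)⟩, ⟨by grind [h.1], by grind [h.2], by grind [h.3]⟩⟩, ?_⟩
  rintro ⟨⟨h₁, h₂, h₃⟩, h⟩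
  refine ⟨by grind [h.1], by grind [h.2], ?_⟩
  simp only [mem_insert]
  rintro _ (rfl | hA) _ (rfl | hB) hne
  exacts [absurd rfl hne, h₃ _ hB, (h₃ _ hA).symm, h.3 _ hA _ hB hne]

lemma isPacking_singleton : IsPacking K R {S} ↔ IsCoseagull K S ∧ S ⊆ R := by
  rw [← insert_empty, isPacking_insert (notMem_empty S)]
  simp [isPacking_empty]

namespace IsPacking

lemma card_biUnion (h : IsPacking K R 𝒯) : #(𝒯.biUnion id) = 3 * #𝒯 :=
  (Finset.card_biUnion h.disjoint).trans
    ((sum_const_nat fun T hT => (h.isCoseagull T hT).card_eq).trans (mul_comm _ _))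

lemma biUnion_subset (h : IsPacking K R 𝒯) : 𝒯.biUnion id ⊆ R :=
  Finset.biUnion_subset.2 h.subset

lemma card_uncovered (h : IsPacking K R 𝒯) : #(uncovered R 𝒯) + 3 * #𝒯 = #R := by
  rw [← h.card_biUnion, uncovered, card_sdiff_add_card_eq_card h.biUnion_subset]

lemma disjoint_of_mem_sdiff (h : IsPacking K R 𝒯) (hS : 𝒮 ⊆ 𝒯)
    (h' : IsPacking K (𝒮.biUnion id ∪ uncovered R 𝒯) 𝒮') {A B : Finset V} (hA : A ∈ 𝒯 \ 𝒮)
    (hB : B ∈ 𝒮') : Disjoint A B := by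
  rw [mem_sdiff] at hA
  refine Disjoint.mono_right (h'.subset B hB) (disjoint_union_right.2 ⟨?_, ?_⟩)
  · exact disjoint_biUnion_right _ _ _ |>.2 fun T hT =>
      h.disjoint _ hA.1 _ (hS hT) fun hAT => hA.2 (hAT ▸ hT)
  · exact disjoint_sdiff.mono_left (subset_biUnion_of_mem id hA.1)

lemma exchange (h : IsPacking K R 𝒯) (hS : 𝒮 ⊆ 𝒯)
    (h' : IsPacking K (𝒮.biUnion id ∪ uncovered R 𝒯) 𝒮') : IsPacking K R (𝒯 \ 𝒮 ∪ 𝒮') where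
  isCoseagull T hT := (mem_union.1 hT).elim (fun hT => h.isCoseagull T (mem_sdiff.1 hT).1)
    (h'.isCoseagull T)
  subset T hT := (mem_union.1 hT).elim (fun hT => h.subset T (mem_sdiff.1 hT).1)
    fun hT => (h'.subset T hT).trans (union_subset
      ((biUnion_subset_biUnion_of_subset_left _ hS).trans h.biUnion_subset) sdiff_subset)
  disjoint A hA B hB hAB := by
    rcases mem_union.1 hA with hA | hA <;> rcases mem_union.1 hB with hB | hB
    · exact h.disjoint _ (mem_sdiff.1 hA).1 _ (mem_sdiff.1 hB).1 hAB
    · exact h.disjoint_of_mem_sdiff hS h' hA hB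
    · exact (h.disjoint_of_mem_sdiff hS h' hB hA).symm
    · exact h'.disjoint _ hA _ hB hAB

lemma card_exchange (h : IsPacking K R 𝒯) (hS : 𝒮 ⊆ 𝒯)
    (h' : IsPacking K (𝒮.biUnion id ∪ uncovered R 𝒯) 𝒮') :
    #(𝒯 \ 𝒮 ∪ 𝒮') + #𝒮 = #𝒯 + #𝒮' := by
  have hdisj : Disjoint (𝒯 \ 𝒮) 𝒮' := Finset.disjoint_left.2 fun A hA hA' =>
    (h'.isCoseagull A hA').nonempty.ne_empty
      (disjoint_self.1 (h.disjoint_of_mem_sdiff hS h' hA hA'))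
  rw [card_union_of_disjoint hdisj, ← card_sdiff_add_card_eq_card hS]
  omega

end IsPacking

lemma exists_isMaxPacking (K : SimpleGraph V) (R : Finset V) : ∃ 𝒯, IsMaxPacking K R 𝒯 := by
  classical
  obtain ⟨𝒯, h𝒯, hmax⟩ := exists_max_image {𝒯 ∈ R.powerset.powerset | IsPacking K R 𝒯} card
    ⟨∅, by simp [isPacking_empty]⟩
  refine ⟨𝒯, (mem_filter.1 h𝒯).2, fun 𝒯' h' => hmax 𝒯' (mem_filter.2 ⟨?_, h'⟩)⟩
  exact mem_powerset.2 fun T hT => mem_powerset.2 (h'.subset T hT)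

namespace IsMaxPacking

variable {S T P Q O : Finset V}

lemma card_le_of_isPacking (h : IsMaxPacking K R 𝒯) (hS : 𝒮 ⊆ 𝒯)
    (h' : IsPacking K (𝒮.biUnion id ∪ uncovered R 𝒯) 𝒮') : #𝒮' ≤ #𝒮 := by
  have := h.2 _ (h.1.exchange hS h')
  have := h.1.card_exchange hS h'
  omega

lemma not_isCoseagull (h : IsMaxPacking K R 𝒯) (hP : P ⊆ uncovered R 𝒯) : ¬IsCoseagull K P := by
  intro hP'
  have := h.card_le_of_isPacking (empty_subset 𝒯) (𝒮' := {P})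
    (by simp [isPacking_singleton, hP', hP])
  simp at this

lemma not_disjoint (h : IsMaxPacking K R 𝒯) (hT : T ∈ 𝒯) (hP : IsCoseagull K P)
    (hQ : IsCoseagull K Q) (hPT : P ⊆ T ∪ uncovered R 𝒯) (hQT : Q ⊆ T ∪ uncovered R 𝒯) :
    ¬Disjoint P Q := by
  intro hPQ
  have hne : P ≠ Q := hPQ.ne hP.nonempty.ne_empty
  have := h.card_le_of_isPacking (singleton_subset_iff.2 hT) (𝒮' := {P, Q}) (by
    rw [isPacking_insert (by simpa), isPacking_singleton]
    simp [hP, hQ, hPT, hQT, hPQ])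
  simp [hne] at this

lemma not_disjoint_three (h : IsMaxPacking K R 𝒯) (hS : S ∈ 𝒯) (hT : T ∈ 𝒯)
    (hO : IsCoseagull K O) (hP : IsCoseagull K P) (hQ : IsCoseagull K Q)
    (hOS : O ⊆ S ∪ T ∪ uncovered R 𝒯) (hPS : P ⊆ S ∪ T ∪ uncovered R 𝒯)
    (hQS : Q ⊆ S ∪ T ∪ uncovered R 𝒯) (hOP : Disjoint O P) (hOQ : Disjoint O Q) :
    ¬Disjoint P Q := by
  intro hPQ
  have hOP' : O ≠ P := hOP.ne hO.nonempty.ne_empty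
  have hOQ' : O ≠ Q := hOQ.ne hO.nonempty.ne_empty
  have hPQ' : P ≠ Q := hPQ.ne hP.nonempty.ne_empty
  have hST : ({S, T} : Finset (Finset V)).biUnion id = S ∪ T := by simp
  have := h.card_le_of_isPacking (insert_subset hS (singleton_subset_iff.2 hT))
    (𝒮' := {O, P, Q}) (by
      rw [hST, isPacking_insert (by simp [hOP', hOQ']), isPacking_insert (by simpa),
        isPacking_singleton]
      exact ⟨⟨hO, hOS, by simp [hOP, hOQ]⟩, ⟨hP, hPS, by simp [hPQ]⟩, hQ, hQS⟩)
  have : #({S, T} : Finset (Finset V)) ≤ 2 := card_le_two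
  have : #({O, P, Q} : Finset (Finset V)) = 3 := card_eq_three.2 ⟨O, P, Q, hOP', hOQ', hPQ', rfl⟩
  omega

lemma swap (h : IsMaxPacking K R 𝒯) (hT : T ∈ 𝒯) (hP : IsCoseagull K P)
    (hPT : P ⊆ T ∪ uncovered R 𝒯) :
    ∃ 𝒯', IsMaxPacking K R 𝒯' ∧ #𝒯' = #𝒯 ∧ (T ∪ uncovered R 𝒯) \ P ⊆ uncovered R 𝒯' := by
  have hT' : ({T} : Finset (Finset V)) ⊆ 𝒯 := singleton_subset_iff.2 hT
  have hP' : IsPacking K (({T} : Finset (Finset V)).biUnion id ∪ uncovered R 𝒯) {P} := by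
    simp [isPacking_singleton, hP, hPT]
  have hcard := h.1.card_exchange hT' hP'
  simp only [card_singleton, add_left_inj] at hcard
  refine ⟨_, ⟨h.1.exchange hT' hP', fun 𝒯' h' => hcard ▸ h.2 𝒯' h'⟩, hcard, fun x hx => ?_⟩
  simp only [mem_sdiff, mem_union, mem_uncovered, mem_singleton] at hx ⊢
  obtain ⟨hxT | ⟨hxR, hx𝒯⟩, hxP⟩ := hx
  · refine ⟨h.1.subset T hT hxT, ?_⟩
    rintro S (⟨hS, hST⟩ | rfl)
    · exact Finset.disjoint_right.1 (h.1.disjoint S hS T hT hST) hxT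
    · exact hxP
  · refine ⟨hxR, ?_⟩
    rintro S (⟨hS, -⟩ | rfl)
    exacts [hx𝒯 S hS, hxP]

end IsMaxPacking

end Packing

lemma not_adj_of_cliqueFree_three {K : SimpleGraph V} (hK : K.CliqueFree 3) {x y z : V}
    (hxy : K.Adj x y) (hyz : K.Adj y z) : ¬K.Adj x z := by
  classical
  exact fun hxz => hK {x, y, z} (SimpleGraph.is3Clique_triple_iff.2 ⟨hxy, hxz, hyz⟩)

/-- The number of neighbours of `x` in `T`. -/
def degreeIn (K : SimpleGraph V) [DecidableRel K.Adj] (T : Finset V) (x : V) : ℕ :=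
  #{y ∈ T | K.Adj x y}

lemma degreeIn_le {K : SimpleGraph V} [DecidableRel K.Adj] {R : Finset V} {k : ℕ}
    (hK : K.CliqueFree 3) (hI : ∀ I ⊆ R, K.IsIndepSet I → #I ≤ k) (x : V) : degreeIn K R x ≤ k :=
  hI _ (filter_subset _ _) fun _ hy _ hz _ =>
    not_adj_of_cliqueFree_three hK (mem_filter.1 hy).2.symm (mem_filter.1 hz).2

section Locked

variable [DecidableEq V] {K : SimpleGraph V} {a b c d e r s t u v w x y z : V}

/-- An induced path `a - b - c` and a coseagull `{u, v, w}` with edge `uv` whose union cannot be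
split into two coseagulls: the situation of a member of a maximum packing with respect to a path
in the set that the packing leaves uncovered. -/
structure Locked (K : SimpleGraph V) (a b c u v w : V) : Prop where
  adj_ab : K.Adj a b
  adj_bc : K.Adj b c
  not_adj_ac : ¬K.Adj a c
  adj_uv : K.Adj u v
  not_adj_uw : ¬K.Adj u w
  not_adj_vw : ¬K.Adj v w
  not_split : ∀ {x y z x' y' z'}, [x, y, z, x', y', z'].Perm [a, b, c, u, v, w] →
    IsCoseagull K {x, y, z} → ¬IsCoseagull K {x', y', z'}

namespace Locked

lemma symm (h : Locked K a b c u v w) : Locked K c b a u v w :=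
  ⟨h.adj_bc.symm, h.adj_ab.symm, fun hca => h.not_adj_ac hca.symm, h.adj_uv, h.not_adj_uw,
    h.not_adj_vw, fun hperm => h.not_split (hperm.trans (by grind))⟩

lemma swap (h : Locked K a b c u v w) : Locked K a b c v u w :=
  ⟨h.adj_ab, h.adj_bc, h.not_adj_ac, h.adj_uv.symm, h.not_adj_vw, h.not_adj_uw,
    fun hperm => h.not_split (hperm.trans (by grind))⟩

-- In the next four lemmas the exchanged pair of triples is, in order, `abv, cuw`, `abw, cuv`,
-- `acu, bvw` and `acw, buv`.
lemma adj_iff_of_not_adj (h : Locked K a b c u v w) (hav : ¬K.Adj a v) (hbv : ¬K.Adj b v) :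
    K.Adj c u ↔ K.Adj c w := by
  have habv := isCoseagull_triple h.adj_ab hav hbv
  constructor <;> intro hc <;> by_contra hc'
  · exact h.not_split (by grind) habv (isCoseagull_triple hc hc' h.not_adj_uw)
  · exact h.not_split (by grind) habv
      (isCoseagull_triple hc hc' fun hwu => h.not_adj_uw hwu.symm)

lemma adj_or_adj_of_not_adj (h : Locked K a b c u v w) (haw : ¬K.Adj a w) (hbw : ¬K.Adj b w) :
    K.Adj c u ∨ K.Adj c v := by
  by_contra! hc
  exact h.not_split (by grind) (isCoseagull_triple h.adj_ab haw hbw)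
    (isCoseagull_triple h.adj_uv (fun huc => hc.1 huc.symm) fun hvc => hc.2 hvc.symm)

lemma adj_of_adj_of_middle_adj (h : Locked K a b c u v w) (hau : K.Adj a u)
    (hb : ¬(K.Adj b v ↔ K.Adj b w)) : K.Adj c u := by
  by_contra hcu
  have hauc := isCoseagull_triple hau h.not_adj_ac fun huc => hcu huc.symm
  by_cases hbv : K.Adj b v
  · exact h.not_split (by grind) hauc
      (isCoseagull_triple hbv (fun hbw => hb (iff_of_true hbv hbw)) h.not_adj_vw)
  · exact h.not_split (by grind) hauc
      (isCoseagull_triple (by tauto) hbv fun hwv => h.not_adj_vw hwv.symm)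

lemma adj_of_adj_of_middle_not_adj (h : Locked K a b c u v w) (haw : K.Adj a w)
    (hbu : ¬K.Adj b u) (hbv : ¬K.Adj b v) : K.Adj c w := by
  by_contra hcw
  exact h.not_split (by grind) (isCoseagull_triple haw h.not_adj_ac fun hwc => hcw hwc.symm)
    (isCoseagull_triple h.adj_uv (fun hub => hbu hub.symm) fun hvb => hbv hvb.symm)

lemma degreeIn_eq [DecidableRel K.Adj] (h : Locked K a b c u v w) (q : V) :
    degreeIn K {u, v, w} q =
      (if K.Adj q u then 1 else 0) + (if K.Adj q v then 1 else 0) +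
        if K.Adj q w then 1 else 0 := by
  have huw : u ≠ w := fun huw => h.not_adj_vw (huw ▸ h.adj_uv.symm)
  have hvw : v ≠ w := fun hvw => h.not_adj_uw (hvw ▸ h.adj_uv)
  rw [degreeIn, card_filter, sum_insert (by simp [h.adj_uv.ne, huw]), sum_pair hvw, add_assoc]

/-- The path and the edge `uv` close up to a five-cycle that `w` does not see. -/
def IsFiveCycle (K : SimpleGraph V) (a b c u v w : V) : Prop :=
  (¬K.Adj a w ∧ ¬K.Adj b w ∧ ¬K.Adj c w) ∧
    (K.Adj a u ∧ K.Adj c v ∨ K.Adj a v ∧ K.Adj c u)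

/-- The only edge between the path and the triple is `bw`. -/
def IsPendant (K : SimpleGraph V) (a b c u v w : V) : Prop :=
  K.Adj b w ∧ (¬K.Adj a u ∧ ¬K.Adj a v ∧ ¬K.Adj a w) ∧ (¬K.Adj b u ∧ ¬K.Adj b v) ∧
    (¬K.Adj c u ∧ ¬K.Adj c v ∧ ¬K.Adj c w)

lemma isFiveCycle_or (hK : K.CliqueFree 3) (h : Locked K a b c u v w) (hbu : ¬K.Adj b u)
    (hbv : ¬K.Adj b v) (hbw : ¬K.Adj b w) : IsFiveCycle K a b c u v w ∨
      K.Adj a w ∧ K.Adj c w ∧ (K.Adj a u ∧ K.Adj c u ∨ K.Adj a v ∧ K.Adj c v) := by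
  have hau : K.Adj a u → ¬K.Adj a v := fun h' => not_adj_of_cliqueFree_three hK h' h.adj_uv
  have hcu : K.Adj c u → ¬K.Adj c v := fun h' => not_adj_of_cliqueFree_three hK h' h.adj_uv
  by_cases haw : K.Adj a w
  · have hcw := h.adj_of_adj_of_middle_not_adj haw hbu hbv
    have hcu' := fun hav => (h.adj_iff_of_not_adj hav hbv).2 hcw
    have hcv' := fun hau => (h.swap.adj_iff_of_not_adj hau hbu).2 hcw
    tauto
  · have hcw : ¬K.Adj c w := fun hcw => haw (h.symm.adj_of_adj_of_middle_not_adj hcw hbu hbv)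
    have hc := h.adj_or_adj_of_not_adj haw hbw
    have ha := h.symm.adj_or_adj_of_not_adj hcw hbw
    have hcu' := fun hav => (h.adj_iff_of_not_adj hav hbv).1
    have hcv' := fun hau => (h.swap.adj_iff_of_not_adj hau hbu).1
    unfold IsFiveCycle
    tauto

lemma four_le_of_adj (hK : K.CliqueFree 3) (h : Locked K a b c u v w) [DecidableRel K.Adj]
    (hbu : K.Adj b u) : 4 ≤ degreeIn K {u, v, w} a + 2 * degreeIn K {u, v, w} b +
      degreeIn K {u, v, w} c := by
  have hau : ¬K.Adj a u := not_adj_of_cliqueFree_three hK h.adj_ab hbu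
  have hcu : ¬K.Adj c u := not_adj_of_cliqueFree_three hK h.adj_bc.symm hbu
  simp only [h.degreeIn_eq, if_pos hbu, if_neg hau, if_neg hcu]
  by_cases hbw : K.Adj b w
  · grind
  · have hav := fun hcv => h.symm.swap.adj_of_adj_of_middle_adj hcv (by tauto)
    have hcv := fun hav => h.swap.adj_of_adj_of_middle_adj hav (by tauto)
    have hcv' := fun haw => h.adj_or_adj_of_not_adj haw hbw
    have hav' := fun hcw => h.symm.adj_or_adj_of_not_adj hcw hbw
    grind

lemma isPendant_or_four_le (hK : K.CliqueFree 3) (h : Locked K a b c u v w)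
    [DecidableRel K.Adj] (hbw : K.Adj b w) : IsPendant K a b c u v w ∨
      4 ≤ degreeIn K {u, v, w} a + 2 * degreeIn K {u, v, w} b + degreeIn K {u, v, w} c := by
  by_cases hbu : K.Adj b u
  · exact .inr (h.four_le_of_adj hK hbu)
  by_cases hbv : K.Adj b v
  · exact .inr (by simpa only [insert_comm v u] using h.swap.four_le_of_adj hK hbv)
  have haw : ¬K.Adj a w := not_adj_of_cliqueFree_three hK h.adj_ab hbw
  have hcw : ¬K.Adj c w := not_adj_of_cliqueFree_three hK h.adj_bc.symm hbw
  have hcu := fun hav => (h.adj_iff_of_not_adj hav hbv).not.2 hcw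
  have hcv := fun hau => (h.swap.adj_iff_of_not_adj hau hbu).not.2 hcw
  have hau := fun hcv => (h.symm.adj_iff_of_not_adj hcv hbv).not.2 haw
  have hav := fun hcu => (h.symm.swap.adj_iff_of_not_adj hcu hbu).not.2 haw
  simp only [h.degreeIn_eq, IsPendant]
  grind

lemma isPendant_or_isFiveCycle (hK : K.CliqueFree 3) (h : Locked K a b c u v w)
    [DecidableRel K.Adj] (hlt : degreeIn K {u, v, w} a + 2 * degreeIn K {u, v, w} b +
      degreeIn K {u, v, w} c < 4) : IsPendant K a b c u v w ∨ IsFiveCycle K a b c u v w := by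
  by_cases hbw : K.Adj b w
  · exact .inl ((h.isPendant_or_four_le hK hbw).resolve_right (by lia))
  have hbu : ¬K.Adj b u := fun hbu => hlt.not_ge (h.four_le_of_adj hK hbu)
  have hbv : ¬K.Adj b v := fun hbv =>
    hlt.not_ge (by simpa only [insert_comm v u] using h.swap.four_le_of_adj hK hbv)
  refine .inr ((h.isFiveCycle_or hK hbu hbv hbw).resolve_right ?_)
  simp only [h.degreeIn_eq] at hlt
  grind

end Locked

/-- A five-cycle in `K` such that the coseagull `{r, s, t}` is locked with each of the five paths
on three consecutive vertices. -/
structure LockedCycle (K : SimpleGraph V) (a b c d e r s t : V) : Prop where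
  abc : Locked K a b c r s t
  bcd : Locked K b c d r s t
  cde : Locked K c d e r s t
  dea : Locked K d e a r s t
  eab : Locked K e a b r s t

namespace LockedCycle

lemma rotate (h : LockedCycle K a b c d e r s t) : LockedCycle K b c d e a r s t :=
  ⟨h.bcd, h.cde, h.dea, h.eab, h.abc⟩

lemma reflect (h : LockedCycle K a b c d e r s t) : LockedCycle K c b a e d r s t :=
  ⟨h.abc.symm, h.eab.symm, h.dea.symm, h.cde.symm, h.bcd.symm⟩

lemma swap (h : LockedCycle K a b c d e r s t) : LockedCycle K a b c d e s r t :=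
  ⟨h.abc.swap, h.bcd.swap, h.cde.swap, h.dea.swap, h.eab.swap⟩

lemma adj_of_adj (hK : K.CliqueFree 3) (h : LockedCycle K a b c d e r s t)
    (hat : K.Adj a t) (hct : K.Adj c t) (har : K.Adj a r) : K.Adj e s := by
  by_contra hes
  have her : ¬K.Adj e r := not_adj_of_cliqueFree_three hK h.eab.adj_ab har
  have het : ¬K.Adj e t := not_adj_of_cliqueFree_three hK h.eab.adj_ab hat
  have hdt : ¬K.Adj d t := not_adj_of_cliqueFree_three hK h.cde.adj_ab.symm hct
  rcases h.dea.isFiveCycle_or hK her hes het with ⟨⟨-, -, hat'⟩, -⟩ | ⟨hdt', -⟩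
  exacts [hat' hat, hdt hdt']

lemma false_of_adj (hK : K.CliqueFree 3) (h : LockedCycle K a b c d e r s t)
    (hat : K.Adj a t) (hct : K.Adj c t) (har : K.Adj a r) (hcr : K.Adj c r) : False :=
  not_adj_of_cliqueFree_three hK h.dea.adj_ab (h.adj_of_adj hK hat hct har)
    (h.reflect.adj_of_adj hK hct hat hcr)

lemma adj_or_adj (hK : K.CliqueFree 3) (h : LockedCycle K a b c d e r s t) :
    K.Adj b r ∨ K.Adj b s := by
  by_contra! hb
  have hdt : ¬K.Adj c t → K.Adj d t := fun hct => by
    by_contra hdt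
    exact (h.bcd.symm.adj_or_adj_of_not_adj hdt hct).elim hb.1 hb.2
  have het : ¬K.Adj a t → K.Adj e t := fun hat => by
    by_contra het
    exact (h.eab.adj_or_adj_of_not_adj het hat).elim hb.1 hb.2
  have hde : K.Adj d t → ¬K.Adj e t := not_adj_of_cliqueFree_three hK h.dea.adj_ab.symm
  have hab : K.Adj a t → ¬K.Adj b t := not_adj_of_cliqueFree_three hK h.abc.adj_ab.symm
  have hcb : K.Adj c t → ¬K.Adj b t := not_adj_of_cliqueFree_three hK h.abc.adj_bc
  have hbt : ¬K.Adj b t := by tauto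
  rcases h.abc.isFiveCycle_or hK hb.1 hb.2 hbt with
    ⟨⟨hat, -, hct⟩, -⟩ | ⟨hat, hct, ⟨har, hcr⟩ | ⟨has, hcs⟩⟩
  · exact hde (hdt hct) (het hat)
  · exact h.false_of_adj hK hat hct har hcr
  · exact h.swap.false_of_adj hK hat hct has hcs

-- Otherwise "adjacent to `r`" would be a proper two-colouring of an odd cycle.
lemma false_of_cliqueFree (hK : K.CliqueFree 3) (h : LockedCycle K a b c d e r s t) : False := by
  have key {a b c d e : V} (h : LockedCycle K a b c d e r s t) : K.Adj a r ↔ ¬K.Adj b r := by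
    have hr : K.Adj a r → ¬K.Adj b r := not_adj_of_cliqueFree_three hK h.abc.adj_ab.symm
    have hs : K.Adj a s → ¬K.Adj b s := not_adj_of_cliqueFree_three hK h.abc.adj_ab.symm
    have ha := h.rotate.rotate.rotate.rotate.adj_or_adj hK
    have hb := h.adj_or_adj hK
    tauto
  have h₁ := key h
  have h₂ := key h.rotate
  have h₃ := key h.rotate.rotate
  have h₄ := key h.rotate.rotate.rotate
  have h₅ := key h.rotate.rotate.rotate.rotate
  tauto

end LockedCycle

end Locked

section Uncovered

variable [DecidableEq V] {K : SimpleGraph V} {R : Finset V} {𝒯 : Finset (Finset V)}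
  {a b c r s t u v w u' v' w' : V}

/-- `{u, v, w}` is a member of the packing `𝒯` whose only edge is `uv`. -/
structure IsMember (K : SimpleGraph V) (𝒯 : Finset (Finset V)) (u v w : V) : Prop where
  mem : {u, v, w} ∈ 𝒯
  adj : K.Adj u v
  not_adj_uw : ¬K.Adj u w
  not_adj_vw : ¬K.Adj v w

/-- `a - b - c` is a path in the set left uncovered by the packing `𝒯`. -/
structure IsUncoveredPath (K : SimpleGraph V) (R : Finset V) (𝒯 : Finset (Finset V))
    (a b c : V) : Prop where
  mem : ∀ q ∈ [a, b, c], q ∈ uncovered R 𝒯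
  ne : a ≠ c
  adj_ab : K.Adj a b
  adj_bc : K.Adj b c

lemma IsPacking.exists_isMember (h : IsPacking K R 𝒯) {T : Finset V} (hT : T ∈ 𝒯) :
    ∃ u v w, T = {u, v, w} ∧ IsMember K 𝒯 u v w := by
  obtain ⟨u, v, w, huv, huw, hvw, rfl⟩ := h.isCoseagull T hT
  exact ⟨u, v, w, rfl, hT, huv, huw, hvw⟩

namespace IsMember

lemma swap (hT : IsMember K 𝒯 u v w) : IsMember K 𝒯 v u w :=
  ⟨insert_comm u v _ ▸ hT.mem, hT.adj.symm, hT.not_adj_vw, hT.not_adj_uw⟩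

lemma nodup (hT : IsMember K 𝒯 u v w) : [u, v, w].Nodup := by
  have huw : u ≠ w := fun huw => hT.not_adj_vw (huw ▸ hT.adj.symm)
  have hvw : v ≠ w := fun hvw => hT.not_adj_uw (hvw ▸ hT.adj)
  simp [hT.adj.ne, huw, hvw]

end IsMember

lemma IsUncoveredPath.nodup (hp : IsUncoveredPath K R 𝒯 a b c) : [a, b, c].Nodup := by
  simp [hp.adj_ab.ne, hp.adj_bc.ne, hp.ne]

lemma triple_subset {x y z : V} {S : Finset V} (hx : x ∈ S) (hy : y ∈ S) (hz : z ∈ S) :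
    {x, y, z} ⊆ S := by
  simp [insert_subset_iff, hx, hy, hz]

lemma disjoint_triple {x y z x' y' z' : V} (h : [x, y, z].Disjoint [x', y', z']) :
    Disjoint ({x, y, z} : Finset V) {x', y', z'} :=
  Finset.disjoint_left.2 fun _ hq hq' => h (by simpa using hq) (by simpa using hq')

namespace IsMaxPacking

lemma not_split (h : IsMaxPacking K R 𝒯) (hT : IsMember K 𝒯 u v w)
    (hnodup : [a, b, c].Nodup) (hmem : ∀ q ∈ [a, b, c], q ∈ uncovered R 𝒯) {x y z x' y' z' : V}
    (hperm : [x, y, z, x', y', z'].Perm [a, b, c, u, v, w]) (hP : IsCoseagull K {x, y, z}) :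
    ¬IsCoseagull K {x', y', z'} := by
  intro hQ
  have hnd : [a, b, c, u, v, w].Nodup := List.Nodup.append hnodup hT.nodup fun q hq hq' =>
    (mem_uncovered.1 (hmem q hq)).2 _ hT.mem (by simpa using hq')
  have hsub : ∀ q ∈ [x, y, z, x', y', z'], q ∈ {u, v, w} ∪ uncovered R 𝒯 := fun q hq => by
    have := hperm.mem_iff.1 hq
    grind
  exact h.not_disjoint hT.mem hP hQ
    (triple_subset (hsub _ (by simp)) (hsub _ (by simp)) (hsub _ (by simp)))
    (triple_subset (hsub _ (by simp)) (hsub _ (by simp)) (hsub _ (by simp)))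
    (disjoint_triple (List.disjoint_of_nodup_append (hperm.nodup_iff.2 hnd)))

lemma not_split_three (h : IsMaxPacking K R 𝒯) (hT : IsMember K 𝒯 u v w)
    (hT' : IsMember K 𝒯 u' v' w') (hne : ({u, v, w} : Finset V) ≠ {u', v', w'})
    (hnodup : [a, b, c].Nodup) (hmem : ∀ q ∈ [a, b, c], q ∈ uncovered R 𝒯)
    {x y z x' y' z' x'' y'' z'' : V}
    (hperm : [x, y, z, x', y', z', x'', y'', z''].Perm [a, b, c, u, v, w, u', v', w'])
    (hO : IsCoseagull K {x, y, z}) (hP : IsCoseagull K {x', y', z'}) :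
    ¬IsCoseagull K {x'', y'', z''} := by
  intro hQ
  have hTT' := h.1.disjoint _ hT.mem _ hT'.mem hne
  have hnd : [a, b, c, u, v, w, u', v', w'].Nodup := by
    have hL := fun q hq => (mem_uncovered.1 (hmem q hq)).2
    refine List.Nodup.append hnodup (List.Nodup.append hT.nodup hT'.nodup fun q hq hq' =>
      Finset.disjoint_left.1 hTT' (by simpa using hq) (by simpa using hq')) fun q hq hq' => ?_
    rcases List.mem_append (s := [u, v, w]).1 hq' with hq' | hq'
    exacts [hL q hq _ hT.mem (by simpa using hq'), hL q hq _ hT'.mem (by simpa using hq')]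
  have hsub : ∀ q ∈ [x, y, z, x', y', z', x'', y'', z''],
      q ∈ {u, v, w} ∪ {u', v', w'} ∪ uncovered R 𝒯 := fun q hq => by
    have := hperm.mem_iff.1 hq
    grind
  obtain ⟨-, hPQ, hO'⟩ := List.nodup_append'.1
    (show ([x, y, z] ++ ([x', y', z'] ++ [x'', y'', z''])).Nodup from hperm.nodup_iff.2 hnd)
  rw [List.disjoint_append_right] at hO'
  exact h.not_disjoint_three hT.mem hT'.mem hO hP hQ
    (triple_subset (hsub _ (by simp)) (hsub _ (by simp)) (hsub _ (by simp)))
    (triple_subset (hsub _ (by simp)) (hsub _ (by simp)) (hsub _ (by simp)))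
    (triple_subset (hsub _ (by simp)) (hsub _ (by simp)) (hsub _ (by simp)))
    (disjoint_triple hO'.1) (disjoint_triple hO'.2)
    (disjoint_triple (List.disjoint_of_nodup_append hPQ))

lemma locked (h : IsMaxPacking K R 𝒯) (hK : K.CliqueFree 3) (hp : IsUncoveredPath K R 𝒯 a b c)
    (hT : IsMember K 𝒯 u v w) : Locked K a b c u v w where
  adj_ab := hp.adj_ab
  adj_bc := hp.adj_bc
  not_adj_ac := not_adj_of_cliqueFree_three hK hp.adj_ab hp.adj_bc
  adj_uv := hT.adj
  not_adj_uw := hT.not_adj_uw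
  not_adj_vw := hT.not_adj_vw
  not_split := h.not_split hT hp.nodup hp.mem

lemma locked_of_perm (h : IsMaxPacking K R 𝒯) (hK : K.CliqueFree 3)
    (hp : IsUncoveredPath K R 𝒯 a b c) (hT : IsMember K 𝒯 u v w) (hT' : IsMember K 𝒯 r s t)
    (hne : ({u, v, w} : Finset V) ≠ {r, s, t}) {x y z p q : V}
    (hperm : [p, q, w, x, y, z].Perm [a, b, c, u, v, w]) (hpq : K.Adj p q) (hpw : ¬K.Adj p w)
    (hqw : ¬K.Adj q w) (hxy : K.Adj x y) (hyz : K.Adj y z) : Locked K x y z r s t where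
  adj_ab := hxy
  adj_bc := hyz
  not_adj_ac := not_adj_of_cliqueFree_three hK hxy hyz
  adj_uv := hT'.adj
  not_adj_uw := hT'.not_adj_uw
  not_adj_vw := hT'.not_adj_vw
  not_split hperm' := h.not_split_three hT hT' hne hp.nodup hp.mem
    (((hperm'.append_left [p, q, w]).trans (hperm.append_right [r, s, t])))
    (isCoseagull_triple hpq hpw hqw)

lemma not_isFiveCycle_of_ne (h : IsMaxPacking K R 𝒯) (hK : K.CliqueFree 3)
    (hp : IsUncoveredPath K R 𝒯 a b c) (hT : IsMember K 𝒯 u v w) (hT' : IsMember K 𝒯 r s t)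
    (hne : ({u, v, w} : Finset V) ≠ {r, s, t}) : ¬Locked.IsFiveCycle K a b c u v w := by
  have key {u v : V} (hT : IsMember K 𝒯 u v w) (hne : ({u, v, w} : Finset V) ≠ {r, s, t})
      (haw : ¬K.Adj a w) (hbw : ¬K.Adj b w) (hcw : ¬K.Adj c w) (hau : K.Adj a u)
      (hcv : K.Adj c v) : LockedCycle K a b c v u r s t :=
    have hlocked {x y z p q : V} := h.locked_of_perm (x := x) (y := y) (z := z) (p := p) (q := q)
      hK hp hT hT' hne
    ⟨hlocked (by grind) hT.adj hT.not_adj_uw hT.not_adj_vw hp.adj_ab hp.adj_bc,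
      hlocked (by grind) hau haw hT.not_adj_uw hp.adj_bc hcv,
      hlocked (by grind) hp.adj_ab haw hbw hcv hT.adj.symm,
      hlocked (by grind) hp.adj_bc hbw hcw hT.adj.symm hau.symm,
      hlocked (by grind) hcv hcw hT.not_adj_vw hau.symm hp.adj_ab⟩
  rintro ⟨⟨haw, hbw, hcw⟩, ⟨hau, hcv⟩ | ⟨hav, hcu⟩⟩
  · exact (key hT hne haw hbw hcw hau hcv).false_of_cliqueFree hK
  · exact (key hT.swap (insert_comm u v _ ▸ hne) haw hbw hcw hav hcu).false_of_cliqueFree hK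

lemma not_isFiveCycle (h : IsMaxPacking K R 𝒯) (hK : K.CliqueFree 3) (hcard : 1 < #𝒯)
    (hp : IsUncoveredPath K R 𝒯 a b c) (hT : IsMember K 𝒯 u v w) :
    ¬Locked.IsFiveCycle K a b c u v w := by
  obtain ⟨T', hT'𝒯, hne⟩ := exists_mem_ne hcard {u, v, w}
  obtain ⟨r, s, t, rfl, hT'⟩ := h.1.exists_isMember hT'𝒯
  exact h.not_isFiveCycle_of_ne hK hp hT hT' hne.symm

lemma adj_of_isPendant (h : IsMaxPacking K R 𝒯) (hp : IsUncoveredPath K R 𝒯 a b c)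
    (hT : IsMember K 𝒯 u v w) (hpend : Locked.IsPendant K a b c u v w)
    (hT' : IsMember K 𝒯 r s t) (hne : ({u, v, w} : Finset V) ≠ {r, s, t})
    (har : K.Adj a r) (hct : K.Adj c t) (hcs : ¬K.Adj c s) : K.Adj u r := by
  obtain ⟨hbw, ⟨hau, -, -⟩, ⟨-, hbv⟩, -⟩ := hpend
  by_contra hur
  exact h.not_split_three hT hT' hne hp.nodup hp.mem
    (by simp only [List.perm_iff_count, List.count_cons]; lia)
    (isCoseagull_triple har hau fun hru => hur hru.symm)
    (isCoseagull_triple hbw hbv fun hwv => hT.not_adj_vw hwv.symm)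
    (isCoseagull_triple hct hcs fun hts => hT'.not_adj_vw hts.symm)

lemma not_isPendant (h : IsMaxPacking K R 𝒯) (hK : K.CliqueFree 3)
    (hp : IsUncoveredPath K R 𝒯 a b c) (hT : IsMember K 𝒯 u v w) (hT' : IsMember K 𝒯 r s t)
    (hne : ({u, v, w} : Finset V) ≠ {r, s, t}) (har : K.Adj a r) (hcr : K.Adj c r)
    (hct : K.Adj c t) : ¬Locked.IsPendant K a b c u v w := by
  intro hpend
  have hcs : ¬K.Adj c s := not_adj_of_cliqueFree_three hK hcr hT'.adj
  have hur := h.adj_of_isPendant hp hT hpend hT' hne har hct hcs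
  have hvr := h.adj_of_isPendant hp hT.swap
    (by unfold Locked.IsPendant at *; tauto) hT' (insert_comm u v _ ▸ hne) har hct hcs
  exact not_adj_of_cliqueFree_three hK hT.adj hvr hur

end IsMaxPacking

end Uncovered

section IndependentUncovered

variable [DecidableEq V] {K : SimpleGraph V} {R : Finset V} {𝒯 : Finset (Finset V)} {k : ℕ}
  {a b c u v w x y : V}

lemma IsPacking.degreeIn_uncovered_add_sum [DecidableRel K.Adj] (h : IsPacking K R 𝒯) (x : V) :
    degreeIn K (uncovered R 𝒯) x + ∑ T ∈ 𝒯, degreeIn K T x = degreeIn K R x := by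
  simp only [degreeIn, card_filter]
  rw [uncovered, ← sum_sdiff h.biUnion_subset,
    sum_biUnion (t := id) h.disjoint]
  rfl

namespace IsMaxPacking

lemma card_uncovered_le [DecidableRel K.Adj] (h : IsMaxPacking K R 𝒯)
    (hx : x ∈ uncovered R 𝒯) (hy : y ∈ uncovered R 𝒯) (hxy : K.Adj x y) :
    #(uncovered R 𝒯) ≤ degreeIn K (uncovered R 𝒯) x + degreeIn K (uncovered R 𝒯) y := by
  refine le_trans (card_le_card fun z hz => ?_) (card_union_le _ _)
  simp only [mem_union, mem_filter, hz, true_and]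
  by_contra! hz'
  exact h.not_isCoseagull (triple_subset hx hy hz) (isCoseagull_triple hxy hz'.1 hz'.2)

lemma exists_isUncoveredPath [DecidableRel K.Adj] (h : IsMaxPacking K R 𝒯)
    (hL : 2 < #(uncovered R 𝒯)) (hx : x ∈ uncovered R 𝒯) (hy : y ∈ uncovered R 𝒯)
    (hxy : K.Adj x y) : ∃ a b c, IsUncoveredPath K R 𝒯 a b c ∧
      #(uncovered R 𝒯) ≤ 2 * degreeIn K (uncovered R 𝒯) b := by
  obtain ⟨b, hb, hbL⟩ : ∃ b ∈ uncovered R 𝒯,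
      #(uncovered R 𝒯) ≤ 2 * degreeIn K (uncovered R 𝒯) b := by
    have := h.card_uncovered_le hx hy hxy
    by_contra! hlt
    linarith [hlt x hx, hlt y hy]
  obtain ⟨a, ha, c, hc, hac⟩ := one_lt_card.1
    (show 1 < #{q ∈ uncovered R 𝒯 | K.Adj b q} from by unfold degreeIn at hbL; lia)
  rw [mem_filter] at ha hc
  exact ⟨a, b, c, ⟨by simp [ha.1, hb, hc.1], hac, ha.2.symm, hc.2⟩, hbL⟩

lemma exists_degreeIn_lt_four [DecidableRel K.Adj] (h : IsMaxPacking K R 𝒯)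
    (hdeg : ∀ q, degreeIn K R q ≤ k) (hR : #R = 3 * k) (hlt : #𝒯 < k)
    (hp : IsUncoveredPath K R 𝒯 a b c) :
    ∃ T ∈ 𝒯, degreeIn K T a + 2 * degreeIn K T b + degreeIn K T c < 4 := by
  apply exists_lt_of_sum_lt
  simp only [sum_add_distrib, ← mul_sum, sum_const, smul_eq_mul]
  have hab := h.card_uncovered_le (hp.mem a (by simp)) (hp.mem b (by simp)) hp.adj_ab
  have hbc := h.card_uncovered_le (hp.mem b (by simp)) (hp.mem c (by simp)) hp.adj_bc
  have := h.1.card_uncovered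
  have hsum := h.1.degreeIn_uncovered_add_sum (K := K)
  linarith [hdeg a, hdeg b, hdeg c, hsum a, hsum b, hsum c]

lemma exists_degreeIn_eq_zero [DecidableRel K.Adj] (h : IsMaxPacking K R 𝒯)
    (hdeg : degreeIn K R b ≤ k) (hR : #R = 3 * k) (hlt : #𝒯 < k)
    (hb : #(uncovered R 𝒯) ≤ 2 * degreeIn K (uncovered R 𝒯) b) :
    ∃ T ∈ 𝒯, degreeIn K T b = 0 := by
  simp only [← Nat.lt_one_iff]
  apply exists_lt_of_sum_lt
  have := h.1.card_uncovered
  have := h.1.degreeIn_uncovered_add_sum (K := K) b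
  simp only [sum_const, smul_eq_mul, mul_one]
  lia

lemma not_adj_of_mem_uncovered (h : IsMaxPacking K R 𝒯) (hK : K.CliqueFree 3)
    (hI : ∀ I ⊆ R, K.IsIndepSet I → #I ≤ k) (hR : #R = 3 * k) (hk : 4 ≤ k) (hlt : #𝒯 < k)
    (hx : x ∈ uncovered R 𝒯) (hy : y ∈ uncovered R 𝒯) : ¬K.Adj x y := by
  classical
  intro hxy
  have hdeg := degreeIn_le hK hI
  have hL := h.1.card_uncovered
  obtain ⟨a, b, c, hp, hb⟩ := h.exists_isUncoveredPath (by lia) hx hy hxy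
  have hcard : 1 < #𝒯 := by
    have := hdeg b
    have := h.1.degreeIn_uncovered_add_sum b
    lia
  obtain ⟨T, hT𝒯, hTlt⟩ := h.exists_degreeIn_lt_four hdeg hR hlt hp
  obtain ⟨T', hT'𝒯, hTb⟩ := h.exists_degreeIn_eq_zero (hdeg b) hR hlt hb
  obtain ⟨u, v, w, rfl, hT⟩ := h.1.exists_isMember hT𝒯
  obtain ⟨r, s, t, rfl, hT'⟩ := h.1.exists_isMember hT'𝒯
  have hpend : Locked.IsPendant K a b c u v w :=
    ((h.locked hK hp hT).isPendant_or_isFiveCycle hK hTlt).resolve_right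
      (h.not_isFiveCycle hK hcard hp hT)
  have hbT' : ∀ q ∈ ({r, s, t} : Finset V), ¬K.Adj b q := filter_eq_empty_iff.1 (card_eq_zero.1 hTb)
  have hne : ({u, v, w} : Finset V) ≠ {r, s, t} := fun heq =>
    hbT' w (heq ▸ by simp) hpend.1
  obtain ⟨-, hct, ⟨har, hcr⟩ | ⟨has, hcs⟩⟩ := ((h.locked hK hp hT').isFiveCycle_or hK
    (hbT' r (by simp)) (hbT' s (by simp)) (hbT' t (by simp))).resolve_left
      (h.not_isFiveCycle hK hcard hp hT')
  · exact h.not_isPendant hK hp hT hT' hne har hcr hct hpend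
  · exact h.not_isPendant hK hp hT hT'.swap (insert_comm r s _ ▸ hne) has hcs hct hpend

end IsMaxPacking

end IndependentUncovered

section OneSided

variable [DecidableEq V] {K : SimpleGraph V} {R : Finset V} {𝒯 : Finset (Finset V)} {k : ℕ}
  {a b c u v w u' v' w' x y : V}

/-- `{u, v, w}` is a member of `𝒯` with edge `uv`, and `u` is its only vertex that may have
neighbours in the set left uncovered. -/
structure IsOneSided (K : SimpleGraph V) (R : Finset V) (𝒯 : Finset (Finset V)) (u v w : V) :
    Prop extends IsMember K 𝒯 u v w where
  not_adj_v : ∀ q ∈ uncovered R 𝒯, ¬K.Adj q v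
  not_adj_w : ∀ q ∈ uncovered R 𝒯, ¬K.Adj q w

namespace IsMaxPacking

lemma not_adj_of_isCoseagull (h : IsMaxPacking K R 𝒯)
    (hind : ∀ 𝒯', IsMaxPacking K R 𝒯' → K.IsIndepSet (uncovered R 𝒯'))
    (hT : IsMember K 𝒯 u v w) (ha : a ∈ uncovered R 𝒯) (hb : b ∈ uncovered R 𝒯) (hab : a ≠ b)
    {x y z p q : V} (hperm : [x, y, z, p, q].Perm [a, b, u, v, w])
    (hP : IsCoseagull K {x, y, z}) : ¬K.Adj p q := by
  intro hpq
  have hnd : [a, b, u, v, w].Nodup :=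
    List.Nodup.append (l₁ := [a, b]) (by simpa) hT.nodup fun r hr hr' => by
      have hrL : r ∈ uncovered R 𝒯 := by grind
      exact (mem_uncovered.1 hrL).2 _ hT.mem (by simpa using hr')
  have hmem : ∀ r ∈ [x, y, z, p, q], r ∈ {u, v, w} ∪ uncovered R 𝒯 := fun r hr => by
    have := hperm.mem_iff.1 hr
    grind
  obtain ⟨𝒯', h', -, hsub⟩ := h.swap hT.mem hP
    (triple_subset (hmem _ (by simp)) (hmem _ (by simp)) (hmem _ (by simp)))
  have hdisj : [x, y, z].Disjoint [p, q] := List.disjoint_of_nodup_append (hperm.nodup_iff.2 hnd)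
  have hmem' : ∀ r ∈ [p, q], r ∈ uncovered R 𝒯' := fun r hr => hsub <| mem_sdiff.2
    ⟨hmem r (List.mem_append_right [x, y, z] hr), fun hr' => hdisj (by simpa using hr') hr⟩
  exact hind 𝒯' h' (hmem' p (by simp)) (hmem' q (by simp)) hpq.ne hpq

lemma adj_outer_of_adj_outer (h : IsMaxPacking K R 𝒯)
    (hind : ∀ 𝒯', IsMaxPacking K R 𝒯' → K.IsIndepSet (uncovered R 𝒯'))
    (hT : IsMember K 𝒯 u v w) (ha : a ∈ uncovered R 𝒯) (haw : K.Adj a w)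
    (hb : b ∈ uncovered R 𝒯) : K.Adj b w := by
  by_contra hbw
  have hab : a ≠ b := fun hab => hbw (hab ▸ haw)
  exact h.not_adj_of_isCoseagull hind hT ha hb hab (by grind)
    (isCoseagull_triple haw (hind 𝒯 h ha hb hab) fun hwb => hbw hwb.symm) hT.adj

lemma adj_or_adj_of_adj_outer (h : IsMaxPacking K R 𝒯)
    (hind : ∀ 𝒯', IsMaxPacking K R 𝒯' → K.IsIndepSet (uncovered R 𝒯'))
    (hT : IsMember K 𝒯 u v w) (ha : a ∈ uncovered R 𝒯) (hb : b ∈ uncovered R 𝒯) (hab : a ≠ b)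
    (hbw : K.Adj b w) : K.Adj a u ∨ K.Adj a v := by
  by_contra! hau
  exact h.not_adj_of_isCoseagull hind hT ha hb hab (by grind)
    (isCoseagull_triple hT.adj (fun hua => hau.1 hua.symm) fun hva => hau.2 hva.symm) hbw

lemma not_adj_outer_of_adj (h : IsMaxPacking K R 𝒯) (hK : K.CliqueFree 3)
    (hind : ∀ 𝒯', IsMaxPacking K R 𝒯' → K.IsIndepSet (uncovered R 𝒯'))
    (hL : 2 < #(uncovered R 𝒯)) (hT : IsMember K 𝒯 u v w) (ha : a ∈ uncovered R 𝒯)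
    (hau : K.Adj a u) : ¬K.Adj a w := by
  intro haw
  have hav : ¬K.Adj a v := not_adj_of_cliqueFree_three hK hau hT.adj
  have hwv : ¬K.Adj w v := fun hwv => hT.not_adj_vw hwv.symm
  have hwu : ¬K.Adj w u := fun hwu => hT.not_adj_uw hwu.symm
  have hout {q} (hq : q ∈ uncovered R 𝒯) (haq : a ≠ q) : ¬K.Adj q u ∧ K.Adj q v := by
    have hqu : ¬K.Adj q u := h.not_adj_of_isCoseagull hind hT ha hq haq
      (by grind) (isCoseagull_triple haw hav hwv)
    exact ⟨hqu, (h.adj_or_adj_of_adj_outer hind hT hq ha haq.symm haw).resolve_left hqu⟩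
  obtain ⟨b, hb, hba⟩ := exists_mem_ne (by lia : 1 < #(uncovered R 𝒯)) a
  obtain ⟨c, hc, hcab⟩ := exists_mem_notMem_of_card_lt_card (card_le_two.trans_lt hL)
  obtain ⟨hca, hcb⟩ : c ≠ a ∧ c ≠ b := by simpa using hcab
  exact h.not_adj_of_isCoseagull hind hT hb hc hcb.symm (by grind)
    (isCoseagull_triple (h.adj_outer_of_adj_outer hind hT ha haw hb) (hout hb hba.symm).1 hwu)
    (hout hc hca.symm).2

lemma not_adj_outer (h : IsMaxPacking K R 𝒯) (hK : K.CliqueFree 3)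
    (hind : ∀ 𝒯', IsMaxPacking K R 𝒯' → K.IsIndepSet (uncovered R 𝒯'))
    (hL : 2 < #(uncovered R 𝒯)) (hT : IsMember K 𝒯 u v w) (ha : a ∈ uncovered R 𝒯) :
    ¬K.Adj a w := by
  intro haw
  obtain ⟨b, hb, hba⟩ := exists_mem_ne (by lia : 1 < #(uncovered R 𝒯)) a
  have hbw := h.adj_outer_of_adj_outer hind hT ha haw hb
  rcases h.adj_or_adj_of_adj_outer hind hT ha hb hba.symm hbw with hau | hav
  · exact h.not_adj_outer_of_adj hK hind hL hT ha hau haw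
  · exact h.not_adj_outer_of_adj hK hind hL hT.swap ha hav haw

lemma isOneSided_of_adj (h : IsMaxPacking K R 𝒯) (hK : K.CliqueFree 3)
    (hind : ∀ 𝒯', IsMaxPacking K R 𝒯' → K.IsIndepSet (uncovered R 𝒯'))
    (hL : 2 < #(uncovered R 𝒯)) (hT : IsMember K 𝒯 u v w) (ha : a ∈ uncovered R 𝒯)
    (hau : K.Adj a u) : IsOneSided K R 𝒯 u v w where
  toIsMember := hT
  not_adj_v b hb hbv := by
    have hab : a ≠ b := fun hab => not_adj_of_cliqueFree_three hK (hab ▸ hau) hT.adj hbv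
    exact h.not_adj_of_isCoseagull hind hT ha hb hab (by grind)
      (isCoseagull_triple hau (h.not_adj_outer hK hind hL hT ha) hT.not_adj_uw) hbv
  not_adj_w _ hb := h.not_adj_outer hK hind hL hT hb

lemma exists_isOneSided (h : IsMaxPacking K R 𝒯) (hK : K.CliqueFree 3)
    (hind : ∀ 𝒯', IsMaxPacking K R 𝒯' → K.IsIndepSet (uncovered R 𝒯'))
    (hL : 2 < #(uncovered R 𝒯)) {T : Finset V} (hT𝒯 : T ∈ 𝒯) :
    ∃ u v w, T = {u, v, w} ∧ IsOneSided K R 𝒯 u v w := by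
  obtain ⟨u, v, w, rfl, hT⟩ := h.1.exists_isMember hT𝒯
  by_cases hv : ∃ a ∈ uncovered R 𝒯, K.Adj a v
  · obtain ⟨a, ha, hav⟩ := hv
    exact ⟨v, u, w, insert_comm _ _ _, h.isOneSided_of_adj hK hind hL hT.swap ha hav⟩
  · push Not at hv
    exact ⟨u, v, w, rfl, hT, hv, fun _ => h.not_adj_outer hK hind hL hT⟩

lemma not_adj_of_isOneSided_inner_inner (h : IsMaxPacking K R 𝒯) (hT : IsOneSided K R 𝒯 u v w)
    (hT' : IsOneSided K R 𝒯 u' v' w') (hne : ({u, v, w} : Finset V) ≠ {u', v', w'})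
    (hnodup : [a, b, c].Nodup) (hmem : ∀ q ∈ [a, b, c], q ∈ uncovered R 𝒯)
    (hau : K.Adj a u) (hbu' : K.Adj b u') : ¬K.Adj v v' := fun hvv' =>
  h.not_split_three hT.toIsMember hT'.toIsMember hne hnodup hmem
    (by simp only [List.perm_iff_count, List.count_cons]; lia)
    (isCoseagull_triple hau (hT.not_adj_w a (hmem a (by simp))) hT.not_adj_uw)
    (isCoseagull_triple hbu' (hT'.not_adj_w b (hmem b (by simp))) hT'.not_adj_uw)
    (isCoseagull_triple hvv' (fun hvc => hT.not_adj_v c (hmem c (by simp)) hvc.symm)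
      fun hvc => hT'.not_adj_v c (hmem c (by simp)) hvc.symm)

lemma not_adj_of_isOneSided_inner_outer (h : IsMaxPacking K R 𝒯) (hT : IsOneSided K R 𝒯 u v w)
    (hT' : IsOneSided K R 𝒯 u' v' w') (hne : ({u, v, w} : Finset V) ≠ {u', v', w'})
    (hnodup : [a, b, c].Nodup) (hmem : ∀ q ∈ [a, b, c], q ∈ uncovered R 𝒯)
    (hau : K.Adj a u) (hcu' : ¬K.Adj c u') : ¬K.Adj v w' := fun hvw' =>
  h.not_split_three hT.toIsMember hT'.toIsMember hne hnodup hmem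
    (by simp only [List.perm_iff_count, List.count_cons]; lia)
    (isCoseagull_triple hau (hT.not_adj_w a (hmem a (by simp))) hT.not_adj_uw)
    (isCoseagull_triple hvw' (fun hvb => hT.not_adj_v b (hmem b (by simp)) hvb.symm)
      fun hwb => hT'.not_adj_w b (hmem b (by simp)) hwb.symm)
    (isCoseagull_triple hT'.adj (fun huc => hcu' huc.symm)
      fun hvc => hT'.not_adj_v c (hmem c (by simp)) hvc.symm)

lemma not_adj_of_isOneSided_outer_outer (h : IsMaxPacking K R 𝒯) (hT : IsOneSided K R 𝒯 u v w)
    (hT' : IsOneSided K R 𝒯 u' v' w') (hne : ({u, v, w} : Finset V) ≠ {u', v', w'})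
    (hnodup : [a, b, c].Nodup) (hmem : ∀ q ∈ [a, b, c], q ∈ uncovered R 𝒯)
    (hbu : ¬K.Adj b u) (hcu' : ¬K.Adj c u') : ¬K.Adj w w' := fun hww' =>
  h.not_split_three hT.toIsMember hT'.toIsMember hne hnodup hmem
    (by simp only [List.perm_iff_count, List.count_cons]; lia)
    (isCoseagull_triple hww' (fun hwa => hT.not_adj_w a (hmem a (by simp)) hwa.symm)
      fun hwa => hT'.not_adj_w a (hmem a (by simp)) hwa.symm)
    (isCoseagull_triple hT.adj (fun hub => hbu hub.symm)
      fun hvb => hT.not_adj_v b (hmem b (by simp)) hvb.symm)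
    (isCoseagull_triple hT'.adj (fun huc => hcu' huc.symm)
      fun hvc => hT'.not_adj_v c (hmem c (by simp)) hvc.symm)

end IsMaxPacking

/-- `x` is the vertex of the one-sided member `T` chosen to enlarge the uncovered set to a bigger
independent set: the inner vertex `v` if `u` has at least two uncovered neighbours, and the outer
vertex `w` otherwise. -/
def IsExtension (K : SimpleGraph V) (R : Finset V) (𝒯 : Finset (Finset V)) (T : Finset V)
    (x : V) : Prop :=
  ∃ u v w, T = {u, v, w} ∧ IsOneSided K R 𝒯 u v w ∧
    (x = v ∧ {q ∈ (uncovered R 𝒯 : Set V) | K.Adj q u}.Nontrivial ∨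
      x = w ∧ {q ∈ (uncovered R 𝒯 : Set V) | K.Adj q u}.Subsingleton)

namespace IsExtension

variable {T : Finset V}

lemma mem (hx : IsExtension K R 𝒯 T x) : x ∈ T := by
  obtain ⟨u, v, w, rfl, -, ⟨rfl, -⟩ | ⟨rfl, -⟩⟩ := hx <;> simp

lemma not_adj_of_mem_uncovered (hx : IsExtension K R 𝒯 T x) (ha : a ∈ uncovered R 𝒯) :
    ¬K.Adj a x := by
  obtain ⟨u, v, w, rfl, hT, ⟨rfl, -⟩ | ⟨rfl, -⟩⟩ := hx
  exacts [hT.not_adj_v a ha, hT.not_adj_w a ha]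

end IsExtension

namespace IsMaxPacking

variable {S T : Finset V}

lemma exists_isExtension (h : IsMaxPacking K R 𝒯) (hK : K.CliqueFree 3)
    (hind : ∀ 𝒯', IsMaxPacking K R 𝒯' → K.IsIndepSet (uncovered R 𝒯'))
    (hL : 2 < #(uncovered R 𝒯)) (hT𝒯 : T ∈ 𝒯) : ∃ x, IsExtension K R 𝒯 T x := by
  obtain ⟨u, v, w, rfl, hT⟩ := h.exists_isOneSided hK hind hL hT𝒯
  rcases Set.subsingleton_or_nontrivial {q ∈ (uncovered R 𝒯 : Set V) | K.Adj q u} with hu | hu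
  exacts [⟨w, u, v, w, rfl, hT, .inr ⟨rfl, hu⟩⟩, ⟨v, u, v, w, rfl, hT, .inl ⟨rfl, hu⟩⟩]

lemma not_adj_inner_inner (h : IsMaxPacking K R 𝒯) (hL : 2 < #(uncovered R 𝒯))
    (hT : IsOneSided K R 𝒯 u v w) (hT' : IsOneSided K R 𝒯 u' v' w')
    (hne : ({u, v, w} : Finset V) ≠ {u', v', w'})
    (hu : {q ∈ (uncovered R 𝒯 : Set V) | K.Adj q u}.Nontrivial)
    (hu' : {q ∈ (uncovered R 𝒯 : Set V) | K.Adj q u'}.Nontrivial) : ¬K.Adj v v' := by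
  obtain ⟨b, ⟨hb, hbu'⟩⟩ := hu'.nonempty
  obtain ⟨a, ⟨ha, hau⟩, hab⟩ := hu.exists_ne b
  obtain ⟨c, hc, hcab⟩ :=
    exists_mem_notMem_of_card_lt_card ((card_le_two (a := a) (b := b)).trans_lt hL)
  exact h.not_adj_of_isOneSided_inner_inner hT hT' hne (c := c) (by grind) (by grind) hau hbu'

lemma not_adj_inner_outer (h : IsMaxPacking K R 𝒯) (hL : 2 < #(uncovered R 𝒯))
    (hT : IsOneSided K R 𝒯 u v w) (hT' : IsOneSided K R 𝒯 u' v' w')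
    (hne : ({u, v, w} : Finset V) ≠ {u', v', w'})
    (hu : {q ∈ (uncovered R 𝒯 : Set V) | K.Adj q u}.Nontrivial)
    (hu' : {q ∈ (uncovered R 𝒯 : Set V) | K.Adj q u'}.Subsingleton) : ¬K.Adj v w' := by
  obtain ⟨a, ⟨ha, hau⟩, b, ⟨hb, hbu⟩, hab⟩ := hu
  obtain ⟨c, hc, hcab⟩ :=
    exists_mem_notMem_of_card_lt_card ((card_le_two (a := a) (b := b)).trans_lt hL)
  by_cases hau' : K.Adj a u'
  · have hcu' : ¬K.Adj c u' := fun hcu' => by have := hu' ⟨ha, hau'⟩ ⟨hc, hcu'⟩; grind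
    exact h.not_adj_of_isOneSided_inner_outer hT hT' hne (a := a) (b := b) (by grind) (by grind)
      hau hcu'
  · exact h.not_adj_of_isOneSided_inner_outer hT hT' hne (a := b) (b := c) (by grind) (by grind)
      hbu hau'

lemma not_adj_outer_outer (h : IsMaxPacking K R 𝒯) (hL : 2 < #(uncovered R 𝒯))
    (hT : IsOneSided K R 𝒯 u v w) (hT' : IsOneSided K R 𝒯 u' v' w')
    (hne : ({u, v, w} : Finset V) ≠ {u', v', w'})
    (hu : {q ∈ (uncovered R 𝒯 : Set V) | K.Adj q u}.Subsingleton)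
    (hu' : {q ∈ (uncovered R 𝒯 : Set V) | K.Adj q u'}.Subsingleton) : ¬K.Adj w w' := by
  obtain ⟨a, ha, b, hb, c, hc, hab, hac, hbc⟩ := two_lt_card.1 hL
  have hu₂ {p q} (hp : p ∈ uncovered R 𝒯) (hq : q ∈ uncovered R 𝒯) (hpq : p ≠ q) :
      ¬K.Adj p u ∨ ¬K.Adj q u := not_and_or.1 fun h' => hpq (hu ⟨hp, h'.1⟩ ⟨hq, h'.2⟩)
  have hu'₂ {p q} (hp : p ∈ uncovered R 𝒯) (hq : q ∈ uncovered R 𝒯) (hpq : p ≠ q) :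
      ¬K.Adj p u' ∨ ¬K.Adj q u' := not_and_or.1 fun h' => hpq (hu' ⟨hp, h'.1⟩ ⟨hq, h'.2⟩)
  obtain ⟨x, y, z, hnodup, hmem, hyu, hzu'⟩ : ∃ x y z, [x, y, z].Nodup ∧
      (∀ q ∈ [x, y, z], q ∈ uncovered R 𝒯) ∧ ¬K.Adj y u ∧ ¬K.Adj z u' := by
    by_cases hau' : K.Adj a u'
    · have hbu' := (hu'₂ ha hb hab).resolve_left (not_not.2 hau')
      have hcu' := (hu'₂ ha hc hac).resolve_left (not_not.2 hau')
      rcases hu₂ hb hc hbc with hbu | hcu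
      exacts [⟨a, b, c, by grind, by grind, hbu, hcu'⟩, ⟨a, c, b, by grind, by grind, hcu, hbu'⟩]
    · rcases hu₂ hb hc hbc with hbu | hcu
      exacts [⟨c, b, a, by grind, by grind, hbu, hau'⟩, ⟨b, c, a, by grind, by grind, hcu, hau'⟩]
  exact h.not_adj_of_isOneSided_outer_outer hT hT' hne hnodup hmem hyu hzu'

lemma not_adj_of_isExtension (h : IsMaxPacking K R 𝒯) (hL : 2 < #(uncovered R 𝒯))
    (hx : IsExtension K R 𝒯 S x) (hy : IsExtension K R 𝒯 T y) (hST : S ≠ T) : ¬K.Adj x y := by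
  obtain ⟨u, v, w, rfl, hS, ⟨rfl, hu⟩ | ⟨rfl, hu⟩⟩ := hx <;>
    obtain ⟨u', v', w', rfl, hT, ⟨rfl, hu'⟩ | ⟨rfl, hu'⟩⟩ := hy
  · exact h.not_adj_inner_inner hL hS hT hST hu hu'
  · exact h.not_adj_inner_outer hL hS hT hST hu hu'
  · exact fun hxy => h.not_adj_inner_outer hL hT hS hST.symm hu' hu hxy.symm
  · exact h.not_adj_outer_outer hL hS hT hST hu hu'

lemma exists_isIndepSet (h : IsMaxPacking K R 𝒯) (hK : K.CliqueFree 3)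
    (hind : ∀ 𝒯', IsMaxPacking K R 𝒯' → K.IsIndepSet (uncovered R 𝒯'))
    (hL : 2 < #(uncovered R 𝒯)) :
    ∃ I ⊆ R, K.IsIndepSet I ∧ #I = #(uncovered R 𝒯) + #𝒯 := by
  have : Nonempty V := (card_pos.1 (by lia : 0 < #(uncovered R 𝒯))).to_type
  choose! x hx using fun T hT => h.exists_isExtension hK hind hL (T := T) hT
  have hinj : Set.InjOn x 𝒯 := fun S hS T hT hST => by
    by_contra hne
    exact Finset.disjoint_left.1 (h.1.disjoint S hS T hT hne) (hx S hS).mem (hST ▸ (hx T hT).mem)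
  have hdisj : Disjoint (uncovered R 𝒯) (𝒯.image x) := by
    rw [Finset.disjoint_right, forall_mem_image]
    exact fun T hT hxT => (mem_uncovered.1 hxT).2 T hT (hx T hT).mem
  refine ⟨uncovered R 𝒯 ∪ 𝒯.image x, union_subset sdiff_subset (image_subset_iff.2 fun T hT =>
    h.1.subset T hT (hx T hT).mem), ?_, by
      rw [card_union_of_disjoint hdisj, card_image_of_injOn hinj]⟩
  rw [coe_union, coe_image]
  rintro p (hp | ⟨S, hS, rfl⟩) q (hq | ⟨T, hT, rfl⟩) hpq
  · exact hind 𝒯 h hp hq hpq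
  · exact (hx T hT).not_adj_of_mem_uncovered hp
  · exact fun hxq => (hx S hS).not_adj_of_mem_uncovered hq hxq.symm
  · exact h.not_adj_of_isExtension hL (hx S hS) (hx T hT) fun hST => hpq (hST ▸ rfl)

end IsMaxPacking

theorem exists_isPacking_card_eq (hK : K.CliqueFree 3)
    (hI : ∀ I ⊆ R, K.IsIndepSet I → #I ≤ k) (hR : #R = 3 * k) (hk : 4 ≤ k) :
    ∃ 𝒯, IsPacking K R 𝒯 ∧ #𝒯 = k := by
  obtain ⟨𝒯, h⟩ := exists_isMaxPacking K R
  have hcard := h.1.card_uncovered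
  refine ⟨𝒯, h.1, eq_of_le_of_not_lt (by lia) fun hlt => ?_⟩
  have hind 𝒯' (h' : IsMaxPacking K R 𝒯') : K.IsIndepSet (uncovered R 𝒯') := fun x hx y hy _ =>
    h'.not_adj_of_mem_uncovered hK hI hR hk ((h.2 𝒯' h'.1).trans_lt hlt) hx hy
  obtain ⟨I, hIR, hI', hIcard⟩ := h.exists_isIndepSet hK hind (by lia)
  have := hI I hIR hI'
  lia

end OneSided

end Coseagull

/-! ### Random matchings -/

section RandomEmbedding

variable {ι κ α : Type*}

lemma exists_trans_toEmbedding_eq [Finite κ] (e e' : κ ↪ α) :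
    ∃ τ : Equiv.Perm α, e.trans τ.toEmbedding = e' := by
  obtain ⟨m, ⟨φ⟩⟩ := Finite.exists_equiv_fin κ
  obtain ⟨τ, hτ⟩ := (MulAction.isMultiplyPretransitive_iff (G := Equiv.Perm α) (α := α)).1
    (Equiv.Perm.isMultiplyPretransitive α m) (φ.symm.toEmbedding.trans e)
    (φ.symm.toEmbedding.trans e')
  refine ⟨τ, ?_⟩
  ext x
  simpa using DFunLike.congr_fun hτ (φ x)

variable [Fintype ι] [Fintype κ] [Fintype α]

lemma expect_embedding_eq_expect_perm [DecidableEq α] (e : κ ↪ α) (F : (κ ↪ α) → ℝ) :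
    𝔼 h, F h = 𝔼 σ : Equiv.Perm α, F (e.trans σ.toEmbedding) := by
  have : Nonempty (κ ↪ α) := ⟨e⟩
  calc 𝔼 h, F h
      = 𝔼 σ : Equiv.Perm α, 𝔼 h : κ ↪ α, F (h.trans σ.toEmbedding) := by
        rw [← Fintype.expect_const (ι := Equiv.Perm α) (𝔼 h, F h)]
        exact expect_congr rfl fun σ _ => (Fintype.expect_equiv
          (Equiv.embeddingCongr (Equiv.refl _) σ) _ _ fun _ => rfl).symm
    _ = 𝔼 h : κ ↪ α, 𝔼 σ : Equiv.Perm α, F (h.trans σ.toEmbedding) := expect_comm ..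
    _ = 𝔼 _h : κ ↪ α, 𝔼 σ : Equiv.Perm α, F (e.trans σ.toEmbedding) := by
        refine expect_congr rfl fun h _ => ?_
        obtain ⟨τ, rfl⟩ := exists_trans_toEmbedding_eq e h
        exact Fintype.expect_equiv (Equiv.mulRight τ) _ _ fun _ => rfl
    _ = _ := Fintype.expect_const _

lemma expect_trans_embedding [Nonempty (ι ↪ α)] (φ : κ ↪ ι) (F : (κ ↪ α) → ℝ) :
    𝔼 g : ι ↪ α, F (φ.trans g) = 𝔼 h, F h := by
  classical
  obtain ⟨g⟩ := ‹Nonempty (ι ↪ α)›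
  rw [expect_embedding_eq_expect_perm g, expect_embedding_eq_expect_perm (φ.trans g)]
  rfl

lemma expect_embedding_apply [Nonempty (ι ↪ α)] (i : ι) (F : α → ℝ) :
    𝔼 g : ι ↪ α, F (g i) = 𝔼 x, F x :=
  (expect_trans_embedding (Function.Embedding.punit i) fun h => F (h ())).trans
    (Fintype.expect_equiv Equiv.uniqueEmbeddingEquivResult _ _ fun _ => rfl)

lemma expect_embedding_apply_pair [Nonempty (ι ↪ α)] {i j : ι} (hij : i ≠ j) (F : α × α → ℝ) :
    𝔼 g : ι ↪ α, F (g i, g j) = 𝔼 q ∈ univ.offDiag, F q := by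
  refine (expect_trans_embedding (Function.Embedding.embFinTwo hij)
    fun h => F (h 0, h 1)).trans ?_
  refine expect_bij' (fun h _ => (h 0, h 1))
    (fun q hq => Function.Embedding.embFinTwo (mem_offDiag.1 hq).2.2) ?_ ?_ ?_ ?_ ?_
  · simp
  · simp
  · intro h _
    ext i
    fin_cases i <;> rfl
  · exact fun _ _ => rfl
  · exact fun _ _ => rfl

end RandomEmbedding

section Selection

variable {ι : Type*}

lemma mul_pred_div_le_sq_div {m M : ℕ} (h : m ≤ M) :
    (m * (m - 1) : ℝ) / (M * (M - 1)) ≤ (m / M) ^ 2 := by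
  rcases le_or_gt M 1 with hM | hM
  · interval_cases M <;> simp
  have hM' : (2 : ℝ) ≤ M := by exact_mod_cast hM
  have hmM : (0 : ℝ) ≤ M - m := sub_nonneg.2 (by exact_mod_cast h)
  rw [div_pow, div_le_div_iff₀ (by nlinarith) (by positivity)]
  nlinarith [mul_nonneg (mul_nonneg m.cast_nonneg M.cast_nonneg : (0 : ℝ) ≤ m * M) hmM]

lemma cast_card_offDiag (S : Finset ι) : (#S.offDiag : ℝ) = #S * (#S - 1) := by
  rw [offDiag_card, Nat.cast_sub (Nat.le_mul_self _)]
  push_cast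
  ring

lemma expect_offDiag (S : Finset ι) (f : ι × ι → ℝ) :
    𝔼 q ∈ S.offDiag, f q = (∑ q ∈ S.offDiag, f q) / (#S * (#S - 1)) := by
  rw [expect_eq_sum_div_card, cast_card_offDiag]

lemma sum_offDiag_map_univ {κ : Type*} [Fintype κ] (e : κ ↪ ι) (f : ι × ι → ℝ) :
    ∑ q ∈ (univ.map e).offDiag, f q = ∑ q ∈ univ.offDiag, f (e q.1, e q.2) := by
  have hmap : (univ.map e).offDiag = univ.offDiag.map (e.prodMap e) := by
    ext ⟨x, y⟩
    simp only [mem_offDiag, mem_map, mem_univ, true_and, Function.Embedding.coe_prodMap,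
      Prod.exists, Prod.map_apply, Prod.mk.injEq]
    constructor
    · rintro ⟨⟨u, rfl⟩, ⟨v, rfl⟩, huv⟩
      exact ⟨u, v, fun h => huv (congrArg e h), rfl, rfl⟩
    · rintro ⟨u, v, huv, rfl, rfl⟩
      exact ⟨⟨u, rfl⟩, ⟨v, rfl⟩, e.injective.ne huv⟩
  rw [hmap, sum_map]
  rfl

lemma exists_subset_card_eq_weight_le {S : Finset ι} {m : ℕ} (hm : m ≤ #S) {c : ι → ℝ}
    {d : ι × ι → ℝ} (hd : ∀ q, 0 ≤ d q) : ∃ s ⊆ S, #s = m ∧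
      ∑ i ∈ s, c i + ∑ q ∈ s.offDiag, d q ≤
        m / #S * ∑ i ∈ S, c i + (m / #S) ^ 2 * ∑ q ∈ S.offDiag, d q := by
  have : Nonempty (Fin m ↪ S) := Function.Embedding.nonempty_of_card_le (by simpa using hm)
  let sub : S ↪ ι := Function.Embedding.subtype _
  have hSmap : univ.map sub = S := attach_map_val
  have hlin : 𝔼 g : Fin m ↪ S, ∑ i, c (g i) = m / #S * ∑ i ∈ S, c i := by
    rw [expect_sum_comm, sum_congr rfl fun i _ => expect_embedding_apply i fun x : S => c x,
      sum_const, card_univ, Fintype.card_fin, nsmul_eq_mul, Fintype.expect_eq_sum_div_card,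
      sum_coe_sort S c, Fintype.card_coe]
    ring
  have hsum : ∑ q ∈ (univ : Finset S).offDiag, d (q.1, q.2) = ∑ q ∈ S.offDiag, d q :=
    (sum_offDiag_map_univ sub d).symm.trans (by rw [hSmap])
  have hquad : 𝔼 g : Fin m ↪ S, ∑ q ∈ univ.offDiag, d (g q.1, g q.2) =
      m * (m - 1) / (#S * (#S - 1)) * ∑ q ∈ S.offDiag, d q := by
    rw [expect_sum_comm, sum_congr rfl fun q hq => expect_embedding_apply_pair
      (mem_offDiag.1 hq).2.2 fun q : S × S => d (q.1, q.2), sum_const, nsmul_eq_mul,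
      expect_offDiag, cast_card_offDiag, card_univ, Fintype.card_fin, card_univ, Fintype.card_coe,
      hsum]
    ring
  obtain ⟨g, -, hg⟩ := exists_le_of_expect_le univ_nonempty
    ((expect_add_distrib _ _ _).trans (congrArg₂ _ hlin hquad)).le
  refine ⟨univ.map (g.trans sub), ?_, by simp, ?_⟩
  · simp [subset_iff, sub]
  rw [sum_map, sum_offDiag_map_univ]
  have hd' : 0 ≤ ∑ q ∈ S.offDiag, d q := sum_nonneg fun q _ => hd q
  exact hg.trans (by gcongr; exact mul_pred_div_le_sq_div hm)

end Selection

section RandomMatching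

variable {ι α : Type*}

/-- The `i`-th edge of the matching encoded by an embedding `g` of `ι × Fin 2`. Embeddings make the
random matching uniform; the price is that its edges are numbered and oriented. -/
def edgeOf (g : ι × Fin 2 ↪ α) (i : ι) : α × α := (g (i, 0), g (i, 1))

/-- The (indices of the) edges of the matching `g` that belong to `A`. -/
def edgesIn [Fintype ι] [DecidableEq α] (A : Finset (α × α)) (g : ι × Fin 2 ↪ α) : Finset ι :=
  {i | edgeOf g i ∈ A}

lemma edgeOf_mem_offDiag [Fintype α] (g : ι × Fin 2 ↪ α) (i : ι) : edgeOf g i ∈ univ.offDiag := by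
  simp [edgeOf]

lemma card_edgesIn [Fintype ι] [DecidableEq α] (A : Finset (α × α))
    (g : ι × Fin 2 ↪ α) :
    (#(edgesIn A g) : ℝ) = ∑ i, if edgeOf g i ∈ A then (1 : ℝ) else 0 :=
  (sum_boole _ _).symm

lemma card_edgesIn_sq [Fintype ι] [DecidableEq α] (A : Finset (α × α))
    (g : ι × Fin 2 ↪ α) :
    (#(edgesIn A g) : ℝ) ^ 2 = #(edgesIn A g) + ∑ q ∈ univ.offDiag,
      (if edgeOf g q.1 ∈ A then (1 : ℝ) else 0) * (if edgeOf g q.2 ∈ A then 1 else 0) := by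
  classical
  simp only [card_edgesIn]
  rw [sq, sum_mul_sum, ← sum_product', ← diag_union_offDiag,
    sum_union (disjoint_diag_offDiag _)]
  congr 1
  rw [sum_diag]
  exact sum_congr rfl fun i _ => by split_ifs <;> simp

variable [Fintype ι] [Fintype α]

lemma expect_edgeOf [Nonempty (ι × Fin 2 ↪ α)] (i : ι) (F : α × α → ℝ) :
    𝔼 g : ι × Fin 2 ↪ α, F (edgeOf g i) = 𝔼 q ∈ univ.offDiag, F q :=
  expect_embedding_apply_pair (by simp) F

lemma sum_edgeOf_edgeOf_le {D : α × α → α × α → ℝ} (hD : ∀ q q', 0 ≤ D q q') :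
    ∑ h : Fin 2 × Fin 2 ↪ α, D (edgeOf h 0) (edgeOf h 1) ≤
      ∑ q ∈ univ.offDiag, ∑ q' ∈ univ.offDiag, D q q' := by
  classical
  have hinj : Function.Injective fun h : Fin 2 × Fin 2 ↪ α => (edgeOf h 0, edgeOf h 1) := by
    intro h h' hh
    simp only [edgeOf, Prod.mk.injEq] at hh
    ext ⟨i, j⟩
    fin_cases i <;> fin_cases j
    exacts [hh.1.1, hh.1.2, hh.2.1, hh.2.2]
  rw [← sum_product', ← sum_image (f := fun q : (α × α) × α × α => D q.1 q.2) hinj.injOn]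
  refine sum_le_sum_of_subset_of_nonneg ?_ fun q _ _ => hD _ _
  rintro q hq
  obtain ⟨h, -, rfl⟩ := mem_image.1 hq
  exact mk_mem_product (edgeOf_mem_offDiag h 0) (edgeOf_mem_offDiag h 1)

lemma expect_edgeOf_edgeOf_le [Nonempty (ι × Fin 2 ↪ α)] {i j : ι} (hij : i ≠ j)
    {D : α × α → α × α → ℝ} (hD : ∀ q q', 0 ≤ D q q') :
    𝔼 g : ι × Fin 2 ↪ α, D (edgeOf g i) (edgeOf g j) ≤
      (∑ q ∈ univ.offDiag, ∑ q' ∈ univ.offDiag, D q q') / (Fintype.card α).descFactorial 4 := by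
  refine (expect_trans_embedding ((Function.Embedding.embFinTwo hij).prodMap (.refl _))
    fun h : Fin 2 × Fin 2 ↪ α => D (edgeOf h 0) (edgeOf h 1)).trans_le ?_
  rw [Fintype.expect_eq_sum_div_card, Fintype.card_embedding_eq]
  exact div_le_div_of_nonneg_right (sum_edgeOf_edgeOf_le hD) (Nat.cast_nonneg _)

lemma expect_sum_edgeOf [Nonempty (ι × Fin 2 ↪ α)] (F : α × α → ℝ) :
    𝔼 g : ι × Fin 2 ↪ α, ∑ i, F (edgeOf g i) =
      Fintype.card ι * ((∑ q ∈ univ.offDiag, F q) /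
        (Fintype.card α * (Fintype.card α - 1))) := by
  rw [expect_sum_comm, sum_congr rfl fun i _ => expect_edgeOf i F, sum_const, card_univ,
    nsmul_eq_mul, expect_offDiag, card_univ]

lemma expect_sum_edgeOf_edgeOf_le [Nonempty (ι × Fin 2 ↪ α)]
    {D : α × α → α × α → ℝ} (hD : ∀ q q', 0 ≤ D q q') :
    𝔼 g : ι × Fin 2 ↪ α, ∑ q ∈ univ.offDiag, D (edgeOf g q.1) (edgeOf g q.2) ≤
      Fintype.card ι * (Fintype.card ι - 1) *
        ((∑ q ∈ univ.offDiag, ∑ q' ∈ univ.offDiag, D q q') /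
          (Fintype.card α).descFactorial 4) := by
  rw [expect_sum_comm]
  refine (sum_le_sum fun q hq => expect_edgeOf_edgeOf_le (mem_offDiag.1 hq).2.2 hD).trans_eq ?_
  rw [sum_const, nsmul_eq_mul, cast_card_offDiag, card_univ]

lemma two_mul_card_le_of_embedding (g : ι × Fin 2 ↪ α) :
    2 * Fintype.card ι ≤ Fintype.card α := by
  have := Fintype.card_le_of_embedding g
  rw [Fintype.card_prod, Fintype.card_fin] at this
  omega

section Variance

variable [DecidableEq α] {A : Finset (α × α)}

/-- The mean number of edges in `A`, for `A` a set of ordered pairs of distinct points. -/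
noncomputable def meanEdgesIn (ι : Type*) [Fintype ι] (A : Finset (α × α)) : ℝ :=
  Fintype.card ι * (#A / (Fintype.card α * (Fintype.card α - 1)))

lemma sum_offDiag_ite_mem (hA : A ⊆ univ.offDiag) :
    ∑ q ∈ univ.offDiag, (if q ∈ A then (1 : ℝ) else 0) = #A := by
  rw [sum_boole, filter_mem_eq_inter, inter_eq_right.2 hA]

lemma expect_card_edgesIn [Nonempty (ι × Fin 2 ↪ α)] (hA : A ⊆ univ.offDiag) :
    𝔼 g : ι × Fin 2 ↪ α, (#(edgesIn A g) : ℝ) = meanEdgesIn ι A := by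
  simp only [card_edgesIn]
  rw [expect_sum_edgeOf fun q => if q ∈ A then (1 : ℝ) else 0, sum_offDiag_ite_mem hA, meanEdgesIn]

lemma expect_card_edgesIn_sq_le [Nonempty (ι × Fin 2 ↪ α)] (hA : A ⊆ univ.offDiag) :
    𝔼 g : ι × Fin 2 ↪ α, (#(edgesIn A g) : ℝ) ^ 2 ≤ meanEdgesIn ι A +
      Fintype.card ι * (Fintype.card ι - 1) *
        ((#A : ℝ) ^ 2 / (Fintype.card α).descFactorial 4) := by
  simp only [card_edgesIn_sq]
  rw [expect_add_distrib, expect_card_edgesIn hA]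
  gcongr
  refine (expect_sum_edgeOf_edgeOf_le (ι := ι) (α := α)
    (D := fun q q' => (if q ∈ A then (1 : ℝ) else 0) * (if q' ∈ A then 1 else 0))
    fun q q' => by positivity).trans_eq ?_
  rw [← sum_mul_sum, sum_offDiag_ite_mem hA, sq]

lemma cast_descFactorial_four {N : ℕ} (hN : 3 ≤ N) :
    (N.descFactorial 4 : ℝ) = N * (N - 1) * (N - 2) * (N - 3) := by
  obtain ⟨M, rfl⟩ := Nat.exists_eq_add_of_le' hN
  simp only [Nat.descFactorial_succ, Nat.descFactorial_zero, Nat.add_sub_cancel]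
  rw [show M + 3 - 2 = M + 1 by omega, show M + 3 - 1 = M + 2 by omega]
  push_cast
  ring

lemma second_moment_sub_sq_mean_le {N h e : ℝ} (hN : 7 ≤ N) (h0 : 0 ≤ h) (hh : 2 * h ≤ N)
    (he0 : 0 ≤ e) (he : 2 * e ≤ N * (N - 1)) :
    h * (e / (N * (N - 1))) + h * (h - 1) * (e ^ 2 / (N * (N - 1) * (N - 2) * (N - 3))) -
      (h * (e / (N * (N - 1)))) ^ 2 ≤ N := by
  have p1 : 0 < N - 1 := by linarith
  have p2 : 0 < N - 2 := by linarith
  have p3 : 0 < N - 3 := by linarith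
  have p0 : 0 < N := by linarith
  obtain ⟨τ, hτ⟩ : ∃ τ, τ = e / (N * (N - 1)) := ⟨_, rfl⟩
  have hτ0 : 0 ≤ τ := hτ ▸ by positivity
  have hτ2 : τ ≤ 1 / 2 := by
    rw [hτ, div_le_iff₀ (by positivity)]
    linarith
  have hratio : N * (N - 1) / ((N - 2) * (N - 3)) ≤ 1 + 8 / N := by
    rw [div_le_iff₀ (by positivity), ← sub_nonneg,
      show (1 + 8 / N) * ((N - 2) * (N - 3)) - N * (N - 1) =
        (4 * N * (N - 7) - 6 * (N - 7) + 6) / N by field_simp; ring]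
    have : 0 ≤ (4 * N - 6) * (N - 7) := mul_nonneg (by linarith) (by linarith)
    exact div_nonneg (by linarith) p0.le
  have hhτ : h * τ ≤ N / 4 := by nlinarith
  calc _ = h * τ + h * (h - 1) * τ ^ 2 * (N * (N - 1) / ((N - 2) * (N - 3))) - (h * τ) ^ 2 := by
        rw [hτ]
        field_simp
    _ ≤ h * τ + h * h * τ ^ 2 * (1 + 8 / N) - (h * τ) ^ 2 := by
        gcongr
        linarith
    _ = h * τ + (h * τ) ^ 2 * 8 / N := by ring
    _ ≤ N / 4 + (N / 4) ^ 2 * 8 / N := by gcongr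
    _ ≤ N := by
        rw [show (N / 4) ^ 2 * 8 / N = N / 2 by field_simp; ring]
        linarith

lemma expect_sq_card_edgesIn_sub_le [Nonempty (ι × Fin 2 ↪ α)] (hN : 7 ≤ Fintype.card α)
    (hA : A ⊆ univ.offDiag)
    (hA2 : 2 * (#A : ℝ) ≤ Fintype.card α * (Fintype.card α - 1)) :
    𝔼 g : ι × Fin 2 ↪ α, ((#(edgesIn A g) : ℝ) - meanEdgesIn ι A) ^ 2 ≤ Fintype.card α := by
  obtain ⟨g⟩ := ‹Nonempty (ι × Fin 2 ↪ α)›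
  have hh : 2 * (Fintype.card ι : ℝ) ≤ Fintype.card α :=
    mod_cast two_mul_card_le_of_embedding g
  calc 𝔼 g : ι × Fin 2 ↪ α, ((#(edgesIn A g) : ℝ) - meanEdgesIn ι A) ^ 2
      = 𝔼 g : ι × Fin 2 ↪ α, (#(edgesIn A g) : ℝ) ^ 2 - meanEdgesIn ι A ^ 2 := by
        simp only [sub_sq]
        rw [expect_add_distrib, expect_sub_distrib, ← expect_mul, ← mul_expect,
          expect_card_edgesIn hA, Fintype.expect_const]
        ring
    _ ≤ _ := sub_le_sub_right (expect_card_edgesIn_sq_le hA) _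
    _ ≤ Fintype.card α := by
        rw [cast_descFactorial_four (by omega)]
        exact second_moment_sub_sq_mean_le (by exact_mod_cast hN) (Nat.cast_nonneg _) hh
          (Nat.cast_nonneg _) hA2

end Variance

end RandomMatching

lemma exists_sq_le_sq_and_le_expect_div {Ω : Type*} [Fintype Ω] [Nonempty Ω] {X T : Ω → ℝ}
    {v t : ℝ} (hT : ∀ ω, 0 ≤ T ω) (hX : 𝔼 ω, X ω ^ 2 ≤ v) (hvt : v < t ^ 2) :
    ∃ ω, X ω ^ 2 ≤ t ^ 2 ∧ T ω ≤ (𝔼 ω, T ω) / (1 - v / t ^ 2) := by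
  obtain ⟨ω₀, -, hω₀⟩ := exists_le_of_expect_le univ_nonempty hX
  have ht : 0 < t ^ 2 := (sq_nonneg _).trans_lt (hω₀.trans_lt hvt)
  have hv : 0 < 1 - v / t ^ 2 := sub_pos.2 ((div_lt_one ht).2 hvt)
  set M := (𝔼 ω, T ω) / (1 - v / t ^ 2) with hM
  have hM0 : 0 ≤ M := div_nonneg (expect_nonneg fun ω _ => hT ω) hv.le
  by_contra! hcon
  -- The potential `T + M X² / t²` has mean at most `M` but exceeds `M` somewhere and never falls
  -- below it.
  have hpot : ∀ ω, M ≤ T ω + M / t ^ 2 * X ω ^ 2 := fun ω => by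
    rcases le_or_gt (X ω ^ 2) (t ^ 2) with h | h
    · exact (hcon ω h).le.trans (le_add_of_nonneg_right (by positivity))
    · calc M = M / t ^ 2 * t ^ 2 := (div_mul_cancel₀ _ ht.ne').symm
        _ ≤ M / t ^ 2 * X ω ^ 2 := by gcongr
        _ ≤ _ := le_add_of_nonneg_left (hT ω)
  have hpot₀ : M < T ω₀ + M / t ^ 2 * X ω₀ ^ 2 :=
    (hcon ω₀ (hω₀.trans hvt.le)).trans_le (le_add_of_nonneg_right (by positivity))
  have hlt : M < 𝔼 ω, (T ω + M / t ^ 2 * X ω ^ 2) := by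
    rw [Fintype.expect_eq_sum_div_card, lt_div_iff₀ (by positivity), mul_comm, ← nsmul_eq_mul,
      ← card_univ, ← sum_const]
    exact sum_lt_sum (fun ω _ => hpot ω) ⟨ω₀, mem_univ _, hpot₀⟩
  refine hlt.not_ge ?_
  calc 𝔼 ω, (T ω + M / t ^ 2 * X ω ^ 2) = 𝔼 ω, T ω + M / t ^ 2 * 𝔼 ω, X ω ^ 2 := by
        rw [expect_add_distrib, mul_expect]
    _ ≤ M * (1 - v / t ^ 2) + M / t ^ 2 * v := by
        gcongr
        rw [hM, div_mul_cancel₀ _ hv.ne']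
    _ = M := by ring

lemma exists_card_edgesIn_le_and_weight_le {ι α : Type*} [Fintype ι] [Fintype α] [DecidableEq α]
    [Nonempty (ι × Fin 2 ↪ α)] {A : Finset (α × α)} {t p : ℝ} {c : α × α → ℝ}
    {d : α × α → α × α → ℝ} (hN : 7 ≤ Fintype.card α) (hA : A ⊆ univ.offDiag)
    (hA2 : 2 * (#A : ℝ) ≤ Fintype.card α * (Fintype.card α - 1)) (ht : 0 ≤ t)
    (hNt : (Fintype.card α : ℝ) < t ^ 2) (hp : 0 ≤ p) (hc : ∀ q, 0 ≤ c q)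
    (hd : ∀ q q', 0 ≤ d q q') :
    ∃ g : ι × Fin 2 ↪ α, #(edgesIn A g) ≤ meanEdgesIn ι A + t ∧
      p * ∑ i, c (edgeOf g i) + p ^ 2 * ∑ q ∈ univ.offDiag, d (edgeOf g q.1) (edgeOf g q.2) ≤
      (p * (Fintype.card ι * ((∑ q ∈ univ.offDiag, c q) /
          (Fintype.card α * (Fintype.card α - 1)))) +
        p ^ 2 * (Fintype.card ι * (Fintype.card ι - 1) *
          ((∑ q ∈ univ.offDiag, ∑ q' ∈ univ.offDiag, d q q') /
            (Fintype.card α).descFactorial 4))) / (1 - Fintype.card α / t ^ 2) := by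
  obtain ⟨g, hgX, hgT⟩ := exists_sq_le_sq_and_le_expect_div
    (T := fun g : ι × Fin 2 ↪ α => p * ∑ i, c (edgeOf g i) +
      p ^ 2 * ∑ q ∈ univ.offDiag, d (edgeOf g q.1) (edgeOf g q.2))
    (fun g => add_nonneg (mul_nonneg hp (sum_nonneg fun i _ => hc _))
      (mul_nonneg (sq_nonneg p) (sum_nonneg fun q _ => hd _ _)))
    (expect_sq_card_edgesIn_sub_le hN hA hA2) hNt
  refine ⟨g, sub_le_iff_le_add'.1 (abs_le_of_sq_le_sq' hgX ht).2, hgT.trans ?_⟩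
  have h1 : 0 ≤ 1 - (Fintype.card α : ℝ) / t ^ 2 :=
    sub_nonneg.2 ((div_le_one ((Nat.cast_nonneg _).trans_lt hNt)).2 hNt.le)
  rw [expect_add_distrib, ← mul_expect, ← mul_expect, expect_sum_edgeOf]
  gcongr
  exact expect_sum_edgeOf_edgeOf_le hd

/-! ### Contracting a matching and seagulls -/

section Contraction

open SimpleGraph

variable {V ι W W' : Type*} {G : SimpleGraph V} {H : SimpleGraph W} {H' : SimpleGraph W'}

/-- The edges of `K`, each counted once in either direction. -/
def adjPairs (K : SimpleGraph V) [Fintype V] [DecidableRel K.Adj] : Finset (V × V) :=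
  {q | K.Adj q.1 q.2}

lemma adjPairs_subset_offDiag [Fintype V] (K : SimpleGraph V)
    [DecidableRel K.Adj] : adjPairs K ⊆ univ.offDiag := by
  intro q hq
  simpa using (mem_filter.1 hq).2.ne

lemma card_adjPairs [Fintype V] (K : SimpleGraph V) [DecidableRel K.Adj] :
    #(adjPairs K) = 2 * K.edgeSet.ncard := by
  classical
  rw [← coe_edgeFinset, Set.ncard_coe_finset, two_mul_card_edgeFinset]
  rfl

lemma card_adjPairs_le [Fintype V] {K : SimpleGraph V} [DecidableRel K.Adj] {k : ℕ}
    (hK : ∀ x, K.degree x ≤ k) : #(adjPairs K) ≤ Fintype.card V * k := by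
  classical
  rw [card_adjPairs, ← coe_edgeFinset, Set.ncard_coe_finset, ← sum_degrees_eq_twice_card_edges,
    ← smul_eq_mul, ← card_univ, ← sum_const]
  exact sum_le_sum fun x _ => hK x

/-- The graph obtained by contracting each of the sets `B i` to a single vertex. -/
def contraction (G : SimpleGraph V) (B : ι → Set V) : SimpleGraph ι where
  Adj i j := i ≠ j ∧ ∃ x ∈ B i, ∃ y ∈ B j, G.Adj x y
  symm := ⟨fun _ _ ⟨hij, x, hx, y, hy, hxy⟩ => ⟨hij.symm, y, hy, x, hx, hxy.symm⟩⟩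
  loopless := ⟨fun _ h => h.1 rfl⟩

lemma compl_adj_of_not_adj_contraction {B : ι → Set V} {i j : ι} (hij : i ≠ j)
    (hdisj : Disjoint (B i) (B j)) (h : ¬(contraction G B).Adj i j) {x y : V} (hx : x ∈ B i)
    (hy : y ∈ B j) : Gᶜ.Adj x y :=
  (compl_adj G x y).2
    ⟨fun hxy => Set.disjoint_left.1 hdisj hx (hxy ▸ hy), fun hxy => h ⟨hij, x, hx, y, hy, hxy⟩⟩

lemma contraction_isMinorOf {B : ι → Set V} (hconn : ∀ i, (G.induce (B i)).Connected)
    (hdisj : Pairwise (Function.onFun Disjoint B)) : (contraction G B).IsMinorOf G :=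
  ⟨B, hconn, fun _ _ hij => hdisj hij, fun _ _ h => h.2⟩

lemma isMinorOf_of_iso (e : H ≃g H') (hH : H.IsMinorOf G) : H'.IsMinorOf G := by
  obtain ⟨B, hconn, hdisj, hadj⟩ := hH
  exact ⟨B ∘ e.symm, fun w => hconn _, fun u w huw => hdisj _ _ (e.symm.injective.ne huw),
    fun u w huw => hadj _ _ (e.symm.map_rel_iff.2 huw)⟩

lemma choose_two_sub_card_edgeSet [Fintype W] (H : SimpleGraph W) [DecidableRel H.Adj] :
    ((Fintype.card W).choose 2 : ℝ) - H.edgeSet.ncard =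
      #{q ∈ (univ : Finset W).offDiag | ¬H.Adj q.1 q.2} / 2 := by
  have hadj : {q ∈ (univ : Finset W).offDiag | H.Adj q.1 q.2} = adjPairs H := by
    ext q
    simpa [adjPairs] using fun h => h.ne
  have hsplit : (2 * H.edgeSet.ncard + #{q ∈ (univ : Finset W).offDiag | ¬H.Adj q.1 q.2} : ℝ) =
      Fintype.card W * (Fintype.card W - 1) := by
    rw [← card_univ, ← cast_card_offDiag]
    exact_mod_cast card_adjPairs H ▸ hadj ▸ card_filter_add_card_filter_not _
  rw [Nat.cast_choose_two]
  linarith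

lemma exists_isMinorOf_of_contraction {J : Finset ι} {n : ℕ} (hJ : #J = n) {B : ι → Set V}
    [DecidableRel (contraction G B).Adj] (hconn : ∀ i ∈ J, (G.induce (B i)).Connected)
    (hdisj : (J : Set ι).PairwiseDisjoint B) :
    ∃ H : SimpleGraph (Fin n), H.IsMinorOf G ∧ (n.choose 2 : ℝ) - H.edgeSet.ncard =
      #{q ∈ J.offDiag | ¬(contraction G B).Adj q.1 q.2} / 2 := by
  classical
  let C := contraction G fun i : J => B i
  have hC : C.IsMinorOf G := contraction_isMinorOf (fun i => hconn i i.2)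
    fun i j hij => hdisj i.2 j.2 (Subtype.coe_ne_coe.2 hij)
  have hadj : ∀ i j : J, C.Adj i j ↔ (contraction G B).Adj i j := fun _ _ =>
    and_congr Subtype.coe_ne_coe.symm Iff.rfl
  have hmissing : (#{q ∈ (univ : Finset J).offDiag | ¬C.Adj q.1 q.2} : ℝ) =
      #{q ∈ J.offDiag | ¬(contraction G B).Adj q.1 q.2} := by
    have hJmap : univ.map (Function.Embedding.subtype (· ∈ J)) = J := attach_map_val
    have hsum := sum_offDiag_map_univ (Function.Embedding.subtype (· ∈ J))
      fun q => if (contraction G B).Adj q.1 q.2 then (0 : ℝ) else 1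
    rw [hJmap] at hsum
    simp only [← sum_boole, hadj, ite_not]
    exact hsum.symm
  have hcard : Fintype.card J = n := by rw [Fintype.card_coe, hJ]
  let e := C.overFinIso hcard
  refine ⟨C.overFin hcard, isMinorOf_of_iso e hC, ?_⟩
  have hedges : (C.overFin hcard).edgeSet.ncard = C.edgeSet.ncard :=
    Nat.card_congr e.mapEdgeSet.symm
  rw [hedges, ← hmissing, ← hcard, choose_two_sub_card_edgeSet]

end Contraction

section BranchSets

open SimpleGraph

variable {V ι : Type*} [DecidableEq V] {G K : SimpleGraph V} {Z R : Finset V}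
  {𝒯 : Finset (Finset V)} {s : Finset ι} {g : ι × Fin 2 ↪ V}

/-- The common neighbours in `Z` of the two entries of `q`. When `Z` is kept, `q` is contracted and
`K` is the complement, each of them gives one missing edge of the contraction. -/
def commonNeighborsIn (K : SimpleGraph V) [DecidableRel K.Adj] (Z : Finset V) (q : V × V) :
    Finset V :=
  {z ∈ Z | K.Adj z q.1 ∧ K.Adj z q.2}

/-- Both entries of `q` are adjacent to both entries of `q'`. When `K` is the complement, this is
the case in which contracting `q` and `q'` produces non-adjacent vertices. -/
def AreJoined (K : SimpleGraph V) (q q' : V × V) : Prop :=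
  (K.Adj q.1 q'.1 ∧ K.Adj q.1 q'.2) ∧ K.Adj q.2 q'.1 ∧ K.Adj q.2 q'.2

instance (K : SimpleGraph V) [DecidableRel K.Adj] (q q' : V × V) : Decidable (AreJoined K q q') :=
  inferInstanceAs (Decidable (_ ∧ _))

/-- The branch sets of the minor: single vertices, triples, and edges of the matching `g`. -/
def branchSet (g : ι × Fin 2 ↪ V) : V ⊕ Finset V ⊕ ι → Set V :=
  Sum.elim (fun z => {z}) (Sum.elim (fun T => T) fun i => {(edgeOf g i).1, (edgeOf g i).2})

lemma IsCoseagull.connected {S : Finset V} (hS : IsCoseagull Gᶜ S) :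
    (G.induce (S : Set V)).Connected := by
  obtain ⟨x, y, z, hxy, hxz, hyz, rfl⟩ := hS
  have hadj : ∀ {u v}, u ≠ v → ¬Gᶜ.Adj u v → G.Adj u v := fun h h' => by
    simpa [compl_adj, h] using h'
  have hxz' : G.Adj x z := hadj (fun h => hyz (h ▸ hxy.symm)) hxz
  have hyz' : G.Adj y z := hadj (fun h => hxz (h ▸ hxy)) hyz
  have hS : (({x, y, z} : Finset V) : Set V) = {x, z} ∪ {z, y} := by
    ext v
    simp
    tauto
  rw [hS]
  exact (induce_union_connected (induce_pair_connected_of_adj hxz').preconnected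
    (induce_pair_connected_of_adj hyz'.symm).preconnected ⟨z, by simp⟩)

lemma IsCoseagull.exists_not_adj (hK : K.CliqueFree 3) {S : Finset V} (hS : IsCoseagull K S)
    (v : V) : ∃ x ∈ S, ¬K.Adj x v := by
  obtain ⟨x, y, z, hxy, -, -, rfl⟩ := hS
  by_contra! hall
  exact not_adj_of_cliqueFree_three hK (hall x (by simp)).symm hxy (hall y (by simp)).symm

lemma connected_branchSet (h𝒯 : IsPacking Gᶜ R 𝒯)
    (hs : ∀ i ∈ s, G.Adj (edgeOf g i).1 (edgeOf g i).2) :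
    ∀ i ∈ Z.disjSum (𝒯.disjSum s), (G.induce (branchSet g i)).Connected := by
  rintro (z | T | i) hi
  · simp only [branchSet, Sum.elim_inl, induce_singleton_eq_top]
    exact connected_top
  · exact (h𝒯.isCoseagull T (by simpa using hi)).connected
  · exact induce_pair_connected_of_adj (hs i (by simpa using hi))

lemma pairwiseDisjoint_branchSet (h𝒯 : IsPacking Gᶜ R 𝒯) (hZR : Disjoint Z R)
    (hgZ : ∀ i ∈ s, ∀ j, g (i, j) ∉ Z) (hgR : ∀ i ∈ s, ∀ j, g (i, j) ∉ R) :
    (Z.disjSum (𝒯.disjSum s) : Set (V ⊕ Finset V ⊕ ι)).PairwiseDisjoint (branchSet g) := by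
  have hTZ : ∀ T ∈ 𝒯, ∀ x ∈ T, x ∉ Z := fun T hT x hx hxZ =>
    Finset.disjoint_left.1 hZR hxZ (h𝒯.subset T hT hx)
  have hgT : ∀ i ∈ s, ∀ j, ∀ T ∈ 𝒯, g (i, j) ∉ T := fun i hi j T hT h =>
    hgR i hi j (h𝒯.subset T hT h)
  rintro (z | T | i) hi (z' | T' | j) hj hij <;>
    simp only [mem_coe, inl_mem_disjSum, inr_mem_disjSum] at hi hj <;>
    simp only [Function.onFun, branchSet, Sum.elim_inl, Sum.elim_inr, edgeOf, Set.disjoint_left,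
      Set.mem_singleton_iff, Set.mem_insert_iff, mem_coe]
  · grind
  · grind
  · grind
  · grind
  · have := Finset.disjoint_left.1 (h𝒯.disjoint T hi T' hj (by grind))
    grind
  · grind
  · grind
  · grind
  · rintro x (rfl | rfl) <;> grind [g.injective.eq_iff]

/-- Triples cause no missing edges, since no vertex is joined in `K` to a whole coseagull. -/
lemma mem_commonNeighborsIn_or_areJoined [DecidableRel K.Adj] (hK : K.CliqueFree 3)
    (hZ : K.IsIndepSet Z) (h𝒯 : ∀ T ∈ 𝒯, IsCoseagull K T) {u v : V ⊕ Finset V ⊕ ι}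
    (hu : u ∈ Z.disjSum (𝒯.disjSum s)) (hv : v ∈ Z.disjSum (𝒯.disjSum s))
    (huv : ∀ x ∈ branchSet g u, ∀ y ∈ branchSet g v, K.Adj x y) :
    (∃ i ∈ s, ∃ z ∈ commonNeighborsIn K Z (edgeOf g i),
      (u, v) = (.inl z, .inr (.inr i)) ∨ (u, v) = (.inr (.inr i), .inl z)) ∨
    ∃ i ∈ s, ∃ j ∈ s, i ≠ j ∧ AreJoined K (edgeOf g i) (edgeOf g j) ∧
      (u, v) = (.inr (.inr i), .inr (.inr j)) := by
  have hT : ∀ T ∈ 𝒯, ∀ y, ¬∀ x ∈ T, K.Adj x y := fun T hT y hall =>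
    have ⟨x, hx, hxy⟩ := (h𝒯 T hT).exists_not_adj hK y
    hxy (hall x hx)
  rcases u with z | T | i <;> rcases v with z' | T' | j <;>
    simp only [branchSet, Sum.elim_inl, Sum.elim_inr, Set.mem_singleton_iff, forall_eq,
      Set.forall_mem_insert, mem_coe, inl_mem_disjSum, inr_mem_disjSum] at hu hv huv
  · exact absurd huv (hZ hu hv huv.ne)
  · exact absurd (fun x hx => (huv x hx).symm) (hT T' hv z)
  · exact .inl ⟨j, hv, z, by simp [commonNeighborsIn, hu, huv], .inl rfl⟩
  · exact absurd huv (hT T hu z')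
  · exact absurd (fun x hx => huv x hx _ (h𝒯 T' hv).nonempty.choose_spec) (hT T hu _)
  · exact absurd (fun x hx => (huv x hx).1) (hT T hu _)
  · exact .inl ⟨i, hu, z', by simp [commonNeighborsIn, hv, huv.1.symm, huv.2.symm], .inr rfl⟩
  · exact absurd (fun x hx => (huv.1 x hx).symm) (hT T' hv _)
  · refine .inr ⟨i, hu, j, hv, ?_, huv, rfl⟩
    rintro rfl
    exact huv.1.1.ne rfl

lemma card_not_adj_contraction_le [DecidableRel G.Adj]
    [DecidableRel (contraction G (branchSet g)).Adj] (hG : Gᶜ.CliqueFree 3) (hZ : G.IsClique Z)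
    (h𝒯 : ∀ T ∈ 𝒯, IsCoseagull Gᶜ T)
    (hdisj : (Z.disjSum (𝒯.disjSum s) : Set (V ⊕ Finset V ⊕ ι)).PairwiseDisjoint (branchSet g)) :
    #{q ∈ (Z.disjSum (𝒯.disjSum s)).offDiag | ¬(contraction G (branchSet g)).Adj q.1 q.2} ≤
      2 * ∑ i ∈ s, #(commonNeighborsIn Gᶜ Z (edgeOf g i)) +
        #{q ∈ s.offDiag | AreJoined Gᶜ (edgeOf g q.1) (edgeOf g q.2)} := by
  classical
  let P : Finset (ι × V) := s.biUnion fun i => {i} ×ˢ commonNeighborsIn Gᶜ Z (edgeOf g i)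
  let Q : Finset (ι × ι) := {q ∈ s.offDiag | AreJoined Gᶜ (edgeOf g q.1) (edgeOf g q.2)}
  have hP : #P ≤ ∑ i ∈ s, #(commonNeighborsIn Gᶜ Z (edgeOf g i)) :=
    card_biUnion_le.trans_eq (by simp)
  have hsub : {q ∈ (Z.disjSum (𝒯.disjSum s)).offDiag |
        ¬(contraction G (branchSet g)).Adj q.1 q.2} ⊆
      P.image (fun q => (.inr (.inr q.1), .inl q.2)) ∪
        P.image (fun q => (.inl q.2, .inr (.inr q.1))) ∪
        Q.image (Prod.map (.inr ∘ .inr) (.inr ∘ .inr)) := by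
    rintro ⟨u, v⟩ huv
    simp only [mem_filter, mem_offDiag] at huv
    obtain ⟨⟨hu, hv, hne⟩, hadj⟩ := huv
    obtain ⟨i, hi, z, hz, h | h⟩ | ⟨i, hi, j, hj, hij, hjoin, h⟩ :=
      mem_commonNeighborsIn_or_areJoined hG ((isIndepSet_compl G).2 hZ) h𝒯 hu hv fun x hx y hy =>
        compl_adj_of_not_adj_contraction hne (hdisj hu hv hne) hadj hx hy
    · simp [P, h, hi, hz]
    · simp [P, h, hi, hz]
    · simp [Q, h, hi, hj, hij, hjoin]
  calc _ ≤ _ := card_le_card hsub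
    _ ≤ #P + #P + #Q := (card_union_le _ _).trans <| add_le_add
        ((card_union_le _ _).trans <| add_le_add card_image_le card_image_le) card_image_le
    _ ≤ _ := by
        rw [two_mul]
        gcongr

/-- The minor obtained by keeping `Z`, contracting `m` edges of `G` outside `Z`, and contracting
`k` triples that partition the remaining vertices. -/
theorem exists_isMinorOf_of_matching [Fintype V] [DecidableRel G.Adj] {n k m : ℕ}
    (hG : Gᶜ.CliqueFree 3) (hω : G.cliqueNum ≤ k) (hk : 4 ≤ k) (hV : Fintype.card V = 2 * n)
    (hn : n = 2 * k + m) (hZ : G.IsNClique k Z) (hgZ : ∀ i, g i ∉ Z) (hsm : #s = m)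
    (hs : ∀ i ∈ s, G.Adj (edgeOf g i).1 (edgeOf g i).2) :
    ∃ H : SimpleGraph (Fin n), H.IsMinorOf G ∧ (n.choose 2 : ℝ) - H.edgeSet.ncard ≤
      ∑ i ∈ s, (#(commonNeighborsIn Gᶜ Z (edgeOf g i)) : ℝ) +
        ∑ q ∈ s.offDiag, if AreJoined Gᶜ (edgeOf g q.1) (edgeOf g q.2) then 1 / 2 else 0 := by
  classical
  let P : Finset V := (s ×ˢ univ).map g
  have hZP : Disjoint Z P := by
    simp only [disjoint_right, P, mem_map]
    rintro _ ⟨i, -, rfl⟩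
    exact hgZ i
  have hR : #(Z ∪ P)ᶜ = 3 * k := by
    have hP : #P = 2 * m := by simp [P, hsm, mul_comm]
    have := card_compl_add_card (Z ∪ P)
    rw [card_union_of_disjoint hZP, hP, hZ.card_eq, hV] at this
    omega
  obtain ⟨𝒯, h𝒯, h𝒯k⟩ := exists_isPacking_card_eq (K := Gᶜ) (R := (Z ∪ P)ᶜ) hG
    (fun I _ hI => ((isIndepSet_compl G).1 hI).card_le_cliqueNum.trans hω) hR hk
  have hdisj := pairwiseDisjoint_branchSet (s := s) (g := g) (Z := Z) h𝒯
    (disjoint_compl_right.mono_left subset_union_left) (fun i _ j => hgZ (i, j))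
    (fun i hi j => by simp [P, hi])
  obtain ⟨H, hH, hmissing⟩ := exists_isMinorOf_of_contraction (n := n)
    (by rw [card_disjSum, card_disjSum, hZ.card_eq, h𝒯k, hsm]; omega)
    (connected_branchSet h𝒯 hs) hdisj
  refine ⟨H, hH, ?_⟩
  have hle := card_not_adj_contraction_le hG hZ.isClique h𝒯.isCoseagull hdisj
  rw [hmissing, ← sum_filter, sum_const, nsmul_eq_mul]
  have hle' : (_ : ℝ) ≤ _ := Nat.cast_le.2 hle
  push_cast at hle'
  linarith

end BranchSets

/-! ### Counting defects -/

section Counting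

open SimpleGraph

variable {V : Type*} [Fintype V] {K : SimpleGraph V} [DecidableRel K.Adj] {k : ℕ}

lemma degree_le_indepNum_of_cliqueFree_three (hK : K.CliqueFree 3) (x : V) :
    K.degree x ≤ K.indepNum := by
  rw [← card_neighborFinset_eq_degree]
  refine IsIndepSet.card_le_indepNum ?_
  simpa using isIndepSet_neighborSet_of_triangleFree K hK x

lemma sum_card_commonNeighborsIn_le (hK : ∀ x, K.degree x ≤ k) (Z : Finset V) :
    ∑ q ∈ univ.offDiag, #(commonNeighborsIn K Z q) ≤ (k - 1) * ∑ z ∈ Z, K.degree z := by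
  classical
  calc ∑ q ∈ univ.offDiag, #(commonNeighborsIn K Z q)
      = ∑ z ∈ Z, #(K.neighborFinset z).offDiag := by
        refine (sum_card_bipartiteAbove_eq_sum_card_bipartiteBelow
          fun (q : V × V) z => K.Adj z q.1 ∧ K.Adj z q.2).trans (sum_congr rfl fun z _ => ?_)
        congr 1
        ext q
        simp [bipartiteBelow, and_comm, and_left_comm]
    _ = ∑ z ∈ Z, (K.degree z - 1) * K.degree z := by
        simp only [offDiag_card, card_neighborFinset_eq_degree, Nat.sub_mul, one_mul]
    _ ≤ ∑ z ∈ Z, (k - 1) * K.degree z := by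
        gcongr with z
        exact hK z
    _ = _ := (mul_sum _ _ _).symm

lemma card_areJoined_le (hK : ∀ x, K.degree x ≤ k) :
    #{q ∈ univ.offDiag ×ˢ univ.offDiag | AreJoined K q.1 q.2} ≤ (k - 1) ^ 2 * #(adjPairs K) := by
  classical
  refine card_le_mul_card_image_of_maps_to (f := fun q => (q.1.1, q.2.1)) ?_ _ ?_
  · intro q hq
    simpa [adjPairs] using (mem_filter.1 hq).2.1.1
  rintro ⟨x, y⟩ hxy
  have hxy : K.Adj x y := (mem_filter.1 hxy).2
  let N : Finset (V × V) := (K.neighborFinset y).erase x ×ˢ (K.neighborFinset x).erase y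
  have hN : #N ≤ (k - 1) ^ 2 := by
    rw [card_product, card_erase_of_mem (by simpa using hxy.symm),
      card_erase_of_mem (by simpa using hxy), sq]
    exact Nat.mul_le_mul (Nat.sub_le_sub_right (hK y) 1) (Nat.sub_le_sub_right (hK x) 1)
  refine (card_le_card_of_injOn (fun q => (q.1.2, q.2.2)) ?_ ?_).trans hN
  · intro q hq
    simp only [mem_coe, mem_filter, mem_product, mem_offDiag, Prod.mk.injEq] at hq
    obtain ⟨⟨⟨⟨-, -, hne⟩, -, -, hne'⟩, ⟨-, h₁⟩, h₂, -⟩, rfl, rfl⟩ := hq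
    simp [N, h₁, h₂.symm, hne.symm, hne'.symm]
  · intro q hq q' hq' heq
    simp only [mem_coe, mem_filter, Prod.mk.injEq] at hq hq' heq
    grind

lemma sum_areJoined_le (hK : ∀ x, K.degree x ≤ k) (hk : 1 ≤ k) :
    ∑ q ∈ univ.offDiag, ∑ q' ∈ univ.offDiag, (if AreJoined K q q' then 1 / 2 else 0 : ℝ) ≤
      (k - 1) ^ 2 * K.edgeSet.ncard := by
  rw [← sum_product', ← sum_filter, sum_const, nsmul_eq_mul]
  have h : (_ : ℝ) ≤ _ := Nat.cast_le.2 (card_areJoined_le hK)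
  rw [card_adjPairs, Nat.cast_mul, Nat.cast_pow, Nat.cast_pred hk] at h
  push_cast at h
  linarith

lemma degree_induce_le (s : Set V) [DecidablePred (· ∈ s)] (x : s) :
    (K.induce s).degree x ≤ K.degree x := by
  rw [← card_neighborFinset_eq_degree, ← card_neighborFinset_eq_degree]
  exact card_le_card_of_injOn Subtype.val (fun y hy => by simpa using hy)
    Subtype.val_injective.injOn

lemma two_mul_card_edgeSet_induce_le (hK : ∀ x, K.degree x ≤ k) (s : Set V)
    [DecidablePred (· ∈ s)] : 2 * (K.induce s).edgeSet.ncard ≤ Fintype.card s * k := by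
  rw [← card_adjPairs]
  exact card_adjPairs_le fun x => (degree_induce_le s x).trans (hK x)

lemma sum_subtype_card_commonNeighborsIn_le (hK : ∀ x, K.degree x ≤ k) (hk : 1 ≤ k)
    (Z : Finset V) (s : Set V) [DecidablePred (· ∈ s)] :
    ∑ q ∈ (univ : Finset s).offDiag, (#(commonNeighborsIn K Z (q.1, q.2)) : ℝ) ≤
      (k - 1) * (∑ z ∈ Z, K.degree z : ℕ) := by
  refine (sum_offDiag_map_univ (Function.Embedding.subtype (· ∈ s))
    fun q => (#(commonNeighborsIn K Z q) : ℝ)).symm.trans_le ?_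
  refine (sum_le_sum_of_subset_of_nonneg (offDiag_mono (subset_univ _)) fun q _ _ =>
    Nat.cast_nonneg _).trans ?_
  rw [← Nat.cast_pred hk]
  exact_mod_cast sum_card_commonNeighborsIn_le hK Z

end Counting

section SparseMatching

variable {ι α : Type*} [Fintype ι] [Fintype α]

lemma mul_div_mul_pred_le {N h q : ℝ} (hN : 2 < N) (hh : 2 * h ≤ N) (hq : 0 ≤ q) :
    h * (q / (N * (N - 1))) ≤ q / (2 * (N - 2)) := by
  calc h * (q / (N * (N - 1))) ≤ N / 2 * (q / (N * (N - 1))) := by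
        have : 0 ≤ q / (N * (N - 1)) := div_nonneg hq (by nlinarith)
        gcongr
        linarith
    _ = q / (2 * (N - 1)) := by field_simp
    _ ≤ q / (2 * (N - 2)) := by
        gcongr
        linarith

lemma mul_pred_mul_div_le {N h q : ℝ} (hN : 4 < N) (h0 : 0 ≤ h) (hh : 2 * h ≤ N) (hq : 0 ≤ q) :
    h * (h - 1) * (q / (N * (N - 1) * (N - 2) * (N - 3))) ≤ q / (4 * (N - 2) * (N - 4)) := by
  have h1 : 0 < N - 1 := by linarith
  have h2 : 0 < N - 2 := by linarith
  have h3 : 0 < N - 3 := by linarith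
  calc h * (h - 1) * (q / (N * (N - 1) * (N - 2) * (N - 3)))
      ≤ N * (N - 2) / 4 * (q / (N * (N - 1) * (N - 2) * (N - 3))) := by
        gcongr
        nlinarith
    _ = q / (4 * (N - 1) * (N - 3)) := by field_simp
    _ ≤ q / (4 * (N - 2) * (N - 4)) := by gcongr <;> linarith

/-- A random matching has few pairs in `A` and small weight, and a random `m`-subset of its other
pairs decreases the weight further. -/
theorem exists_matching_subset_weight_le [Nonempty (ι × Fin 2 ↪ α)]
    {A : Finset (α × α)} {t p : ℝ} {c : α × α → ℝ} {d : α × α → α × α → ℝ} {m : ℕ}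
    (hN : 7 ≤ Fintype.card α) (hA : A ⊆ univ.offDiag)
    (hA2 : 2 * (#A : ℝ) ≤ Fintype.card α * (Fintype.card α - 1)) (ht : 0 ≤ t)
    (hNt : (Fintype.card α : ℝ) < t ^ 2) (hp : 0 ≤ p) (hp1 : p ≤ 1) (hc : ∀ q, 0 ≤ c q)
    (hd : ∀ q q', 0 ≤ d q q')
    (hm : m ≤ p * (Fintype.card ι - #A / (2 * (Fintype.card α - 2)) - t)) :
    ∃ (g : ι × Fin 2 ↪ α) (s : Finset ι), #s = m ∧ (∀ i ∈ s, edgeOf g i ∉ A) ∧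
      ∑ i ∈ s, c (edgeOf g i) + ∑ q ∈ s.offDiag, d (edgeOf g q.1) (edgeOf g q.2) ≤
        (p * ((∑ q ∈ univ.offDiag, c q) / (2 * (Fintype.card α - 2))) +
          p ^ 2 * ((∑ q ∈ univ.offDiag, ∑ q' ∈ univ.offDiag, d q q') /
            (4 * (Fintype.card α - 2) * (Fintype.card α - 4)))) /
          (1 - Fintype.card α / t ^ 2) := by
  classical
  obtain ⟨g, hgA, hgw⟩ := exists_card_edgesIn_le_and_weight_le (ι := ι) hN hA hA2 ht hNt hp hc hd
  have hN' : (7 : ℝ) ≤ Fintype.card α := by exact_mod_cast hN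
  have hι : 2 * (Fintype.card ι : ℝ) ≤ Fintype.card α := by
    exact_mod_cast two_mul_card_le_of_embedding g
  have hmean : meanEdgesIn ι A ≤ #A / (2 * (Fintype.card α - 2)) :=
    mul_div_mul_pred_le (by linarith) hι (Nat.cast_nonneg _)
  have hS : (Fintype.card ι : ℝ) - #A / (2 * (Fintype.card α - 2)) - t ≤ #(edgesIn A g)ᶜ := by
    have : (#(edgesIn A g)ᶜ + #(edgesIn A g) : ℝ) = Fintype.card ι := by
      exact_mod_cast card_compl_add_card _
    linarith
  have hmp : m ≤ p * #(edgesIn A g)ᶜ := hm.trans (by gcongr)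
  have hmS : m ≤ #(edgesIn A g)ᶜ := by
    exact_mod_cast hmp.trans (mul_le_of_le_one_left (Nat.cast_nonneg _) hp1)
  have hq : (m : ℝ) / #(edgesIn A g)ᶜ ≤ p := div_le_of_le_mul₀ (Nat.cast_nonneg _) hp hmp
  obtain ⟨s, hsS, hsm, hsw⟩ := exists_subset_card_eq_weight_le hmS
    (c := fun i => c (edgeOf g i)) (d := fun q => d (edgeOf g q.1) (edgeOf g q.2)) fun q => hd _ _
  refine ⟨g, s, hsm, fun i hi => by simpa [edgesIn] using hsS hi,
    hsw.trans (le_trans ?_ (hgw.trans ?_))⟩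
  · gcongr ?_ * ?_ + ?_ ^ 2 * ?_
    · exact sum_nonneg fun i _ => hc _
    · exact sum_le_univ_sum_of_nonneg fun i => hc _
    · exact sum_nonneg fun q _ => hd _ _
    · exact sum_le_sum_of_subset_of_nonneg (offDiag_mono (subset_univ _)) fun q _ _ => hd _ _
  · rw [cast_descFactorial_four (by omega)]
    gcongr ?_ / ?_
    · exact sub_nonneg.2 ((div_le_one ((Nat.cast_nonneg _).trans_lt hNt)).2 hNt.le)
    · gcongr
      · exact mul_div_mul_pred_le (by linarith) hι (sum_nonneg fun q _ => hc _)
      · exact mul_pred_mul_div_le (by linarith) (Nat.cast_nonneg _) hι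
          (sum_nonneg fun q _ => sum_nonneg fun q' _ => hd _ _)

end SparseMatching

section Minor

open SimpleGraph

lemma exists_matching_compl_weight_le {W : Type*} [Fintype W] {K : SimpleGraph W}
    [DecidableRel K.Adj] {k m : ℕ} {t p : ℝ} {c : W × W → ℝ} (hN : 7 ≤ Fintype.card W)
    (hK : ∀ x, K.degree x ≤ k) (hk : 1 ≤ k) (hkN : 2 * k < Fintype.card W) (ht : 0 ≤ t)
    (hNt : (Fintype.card W : ℝ) < t ^ 2) (hp : 0 ≤ p) (hp1 : p ≤ 1) (hc : ∀ q, 0 ≤ c q)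
    (hm : (m : ℝ) ≤ p * ((Fintype.card W - 1) / 2 -
      K.edgeSet.ncard / (Fintype.card W - 2) - t)) :
    ∃ (g : Fin (Fintype.card W / 2) × Fin 2 ↪ W) (s : Finset (Fin (Fintype.card W / 2))),
      #s = m ∧ (∀ i ∈ s, Kᶜ.Adj (edgeOf g i).1 (edgeOf g i).2) ∧
      ∑ i ∈ s, c (edgeOf g i) +
          ∑ q ∈ s.offDiag, (if AreJoined K (edgeOf g q.1) (edgeOf g q.2) then 1 / 2 else 0) ≤
        (p * ((∑ q ∈ univ.offDiag, c q) / (2 * (Fintype.card W - 2))) +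
          p ^ 2 * (((k - 1) ^ 2 * K.edgeSet.ncard) /
            (4 * (Fintype.card W - 2) * (Fintype.card W - 4)))) /
          (1 - Fintype.card W / t ^ 2) := by
  have hN' : (7 : ℝ) ≤ Fintype.card W := by exact_mod_cast hN
  have hA : (#(adjPairs K) : ℝ) = 2 * K.edgeSet.ncard := by exact_mod_cast card_adjPairs K
  have hA2 : 2 * (#(adjPairs K) : ℝ) ≤ Fintype.card W * (Fintype.card W - 1) := by
    have h : (#(adjPairs K) : ℝ) ≤ Fintype.card W * k := by exact_mod_cast card_adjPairs_le hK
    have : 2 * (k : ℝ) + 1 ≤ Fintype.card W := by exact_mod_cast hkN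
    nlinarith
  have hhalf : ((Fintype.card W : ℝ) - 1) / 2 ≤ Fintype.card (Fin (Fintype.card W / 2)) := by
    have : (Fintype.card W : ℝ) ≤ 2 * (Fintype.card W / 2 : ℕ) + 1 := by
      exact_mod_cast (by omega)
    rw [Fintype.card_fin]
    linarith
  have : Nonempty (Fin (Fintype.card W / 2) × Fin 2 ↪ W) :=
    Function.Embedding.nonempty_of_card_le (by simpa using Nat.div_mul_le_self _ 2)
  obtain ⟨g, s, hsm, hsA, hsw⟩ := exists_matching_subset_weight_le
    (ι := Fin (Fintype.card W / 2)) (m := m)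
    (d := fun q q' => if AreJoined K q q' then 1 / 2 else 0) hN (adjPairs_subset_offDiag K) hA2
    ht hNt hp hp1 hc (fun q q' => by positivity) (by
      rw [hA, mul_div_mul_left _ _ two_ne_zero]
      exact hm.trans (by gcongr))
  refine ⟨g, s, hsm, fun i hi => ?_, hsw.trans ?_⟩
  · exact (compl_adj ..).2 ⟨g.injective.ne (by simp), by simpa [adjPairs] using hsA i hi⟩
  · gcongr
    · exact sub_nonneg.2 ((div_le_one (by linarith)).2 hNt.le)
    · exact mul_nonneg (by linarith) (by linarith)
    · exact sum_areJoined_le hK hk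

variable {V : Type*} [Fintype V] [DecidableEq V] {G : SimpleGraph V} [DecidableRel G.Adj]
  {Z : Finset V} {n k : ℕ}

lemma degree_compl_le (hG : Gᶜ.CliqueFree 3) (hω : G.cliqueNum ≤ k) (x : V) : Gᶜ.degree x ≤ k :=
  (degree_le_indepNum_of_cliqueFree_three hG x).trans (by rwa [indepNum_compl])

lemma cast_card_notMem (hV : Fintype.card V = 2 * n) (hZ : #Z = k) :
    (Fintype.card {v : V | v ∉ Z} : ℝ) = 2 * n - k := by
  have hcard : Fintype.card {v : V | v ∉ Z} + k = 2 * n := by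
    rw [Fintype.card_of_subtype Zᶜ fun x => by simp, ← hV, ← hZ]
    exact card_compl_add_card Z
  rw [eq_sub_iff_add_eq]
  exact_mod_cast hcard

theorem exists_isMinorOf_missing_le {t p : ℝ} (hG : Gᶜ.CliqueFree 3) (hω : G.cliqueNum ≤ k)
    (hk : 4 ≤ k) (hV : Fintype.card V = 2 * n) (hkn : 2 * k ≤ n) (hZ : G.IsNClique k Z)
    (ht : 0 ≤ t) (hNt : 2 * (n : ℝ) - k < t ^ 2) (hp : 0 ≤ p) (hp1 : p ≤ 1)
    (hm : (n : ℝ) - 2 * k ≤ p * (n - (k + 1) / 2 -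
      (Gᶜ.induce {v : V | v ∉ Z}).edgeSet.ncard / (2 * n - k - 2) - t)) :
    ∃ H : SimpleGraph (Fin n), H.IsMinorOf G ∧ (n.choose 2 : ℝ) - H.edgeSet.ncard ≤
      (p * (((k - 1) * (∑ z ∈ Z, Gᶜ.degree z : ℕ)) / (2 * (2 * n - k - 2))) +
        p ^ 2 * (((k - 1) ^ 2 * (Gᶜ.induce {v : V | v ∉ Z}).edgeSet.ncard) /
          (4 * (2 * n - k - 2) * (2 * n - k - 4)))) / (1 - (2 * n - k) / t ^ 2) := by
  let W : Set V := {v : V | v ∉ Z}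
  have hK := degree_compl_le hG hω
  have hN : (Fintype.card W : ℝ) = 2 * n - k := cast_card_notMem hV hZ.card_eq
  have hkn' : 2 * (k : ℝ) ≤ n := by exact_mod_cast hkn
  have hk' : (4 : ℝ) ≤ k := by exact_mod_cast hk
  have hN7 : 7 ≤ Fintype.card W := by
    have : (7 : ℝ) ≤ Fintype.card W := by linarith
    exact_mod_cast this
  have hkN : 2 * k < Fintype.card W := by
    have : 2 * (k : ℝ) < Fintype.card W := by linarith
    exact_mod_cast this
  obtain ⟨g, s, hsm, hsG, hsw⟩ := exists_matching_compl_weight_le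
    (K := Gᶜ.induce W) (m := n - 2 * k)
    (c := fun q : W × W => (#(commonNeighborsIn Gᶜ Z (q.1, q.2)) : ℝ)) hN7
    (fun x : W => (degree_induce_le W x).trans (hK x)) (by omega) hkN ht (by rwa [hN]) hp hp1
    (fun q => Nat.cast_nonneg _) (by
      rw [hN, Nat.cast_sub hkn, Nat.cast_mul, Nat.cast_two]
      convert hm using 4
      ring)
  rw [hN] at hsw
  obtain ⟨H, hH, hHle⟩ := exists_isMinorOf_of_matching (g := g.trans (.subtype _)) hG hω hk hV
    (by omega) hZ (fun i => (g i).2) hsm fun i hi => by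
      obtain ⟨hne, hnot⟩ := (compl_adj ..).1 (hsG i hi)
      by_contra hG'
      exact hnot ((compl_adj ..).2 ⟨Subtype.val_injective.ne hne, hG'⟩)
  refine ⟨H, hH, hHle.trans (hsw.trans ?_)⟩
  gcongr
  · exact sub_nonneg.2 ((div_le_one (by linarith)).2 hNt.le)
  · linarith
  · exact sum_subtype_card_commonNeighborsIn_le hK (by omega) Z W

end Minor

section Parameters

variable {n k b lam : ℝ}

lemma sub_two_mul_le_sub (hk : 0 ≤ k) (hN : 4 ≤ 2 * n - k) (hb : 2 * b ≤ (2 * n - k) * k)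
    (hlam : lam ≤ (k - 1) / 2) :
    n - 2 * k ≤ n - (k + 1) / 2 - b / (2 * n - k - 2) - lam := by
  have : b / (2 * n - k - 2) ≤ k := (div_le_iff₀ (by linarith)).2 (by nlinarith)
  linarith

lemma four_le_of_two_mul_lt_sq (hk : 0 ≤ k) (hn : 3 ≤ n) (hlam0 : 0 ≤ lam)
    (hlam1 : lam ≤ (k - 1) / 2) (hlam2 : 2 * n < lam ^ 2) : 4 ≤ k := by
  nlinarith

lemma weight_div_le {a p : ℝ} (ha : 0 ≤ a) (hb : 0 ≤ b) (hp : 0 ≤ p) (hk : 1 ≤ k)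
    (hN : 4 ≤ 2 * n - k) (hlam : 2 * n < lam ^ 2) :
    (p * ((k - 1) * a / (2 * (2 * n - k - 2))) +
        p ^ 2 * ((k - 1) ^ 2 * b / (4 * (2 * n - k - 2) * (2 * n - k - 4)))) /
        (1 - (2 * n - k) / lam ^ 2) ≤
      1 / (1 - 2 * n / lam ^ 2) * (b * (k - 1) ^ 2 * p ^ 2 /
          (4 * (2 * n - k - 2) * (2 * n - k - 4)) + a * (k - 1) * p / (2 * (2 * n - k - 2))) := by
  have : 0 ≤ k - 1 := by linarith
  have : 0 ≤ 2 * n - k - 2 := by linarith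
  have : 0 ≤ 2 * n - k - 4 := by linarith
  have hpos : 0 < 1 - 2 * n / lam ^ 2 := sub_pos.2 ((div_lt_one (by linarith)).2 hlam)
  calc _ = (b * (k - 1) ^ 2 * p ^ 2 / (4 * (2 * n - k - 2) * (2 * n - k - 4)) +
        a * (k - 1) * p / (2 * (2 * n - k - 2))) / (1 - (2 * n - k) / lam ^ 2) := by ring
    _ ≤ _ := by
      rw [one_div_mul_eq_div]
      gcongr
      linarith

end Parameters

theorem lemmal {V : Type*} [Fintype V] [DecidableEq V]
    (G : SimpleGraph V) [DecidableRel G.Adj] (n k : ℕ)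
    (hn : Fintype.card V = 2 * n) (h6 : 6 ≤ Fintype.card V)
    (hα : G.indepNum ≤ 2)
    (hk : k = G.cliqueNum) (hω : (k : ℝ) < (Fintype.card V : ℝ) / 4)
    (Z : Finset V) (hZ : G.IsNClique k Z)
    (a b : ℕ)
    (ha : a = ∑ v ∈ Z, Gᶜ.degree v)
    (hb : b = (Gᶜ.induce {v : V | v ∉ Z}).edgeSet.ncard)
    (lam : ℝ) (hlam0 : 0 < lam) (hlam1 : lam ≤ ((k : ℝ) - 1) / 2)
    (hlam2 : 2 * (n : ℝ) < lam ^ 2)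
    (p : ℝ)
    (hp : p = ((n : ℝ) - 2 * k) /
      ((n : ℝ) - ((k : ℝ) + 1) / 2 - (b : ℝ) / (2 * (n : ℝ) - k - 2) - lam)) :
    ∃ H : SimpleGraph (Fin n), H.IsMinorOf G ∧
      (n.choose 2 : ℝ) - (H.edgeSet.ncard : ℝ) ≤
        1 / (1 - 2 * (n : ℝ) / lam ^ 2) *
          ((b : ℝ) * ((k : ℝ) - 1) ^ 2 * p ^ 2 /
              (4 * (2 * (n : ℝ) - k - 2) * (2 * (n : ℝ) - k - 4)) +
            (a : ℝ) * ((k : ℝ) - 1) * p / (2 * (2 * (n : ℝ) - k - 2))) := by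
  have hn3 : (3 : ℝ) ≤ n := by exact_mod_cast (by omega : 3 ≤ n)
  have hkn : 2 * (k : ℝ) < n := by
    rw [hn, Nat.cast_mul, Nat.cast_two] at hω
    linarith
  have hk4 : (4 : ℝ) ≤ k := four_le_of_two_mul_lt_sq k.cast_nonneg hn3 hlam0.le hlam1 hlam2
  have hGc : Gᶜ.CliqueFree 3 := G.cliqueFree_compl.2 fun s hs =>
    (hs.card_eq ▸ hs.isIndepSet.card_le_indepNum).not_gt (by omega)
  have hbN : 2 * (b : ℝ) ≤ (2 * n - k) * k := by
    rw [← cast_card_notMem hn hZ.card_eq, hb]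
    exact_mod_cast two_mul_card_edgeSet_induce_le (degree_compl_le hGc hk.ge) _
  have hD := sub_two_mul_le_sub k.cast_nonneg (by linarith) hbN hlam1
  have hp0 : 0 ≤ p := hp ▸ div_nonneg (by linarith) (by linarith)
  have hp1 : p ≤ 1 := hp ▸ div_le_one_of_le₀ hD (by linarith)
  obtain ⟨H, hH, hle⟩ := exists_isMinorOf_missing_le hGc hk.ge (by exact_mod_cast hk4) hn
    (by exact_mod_cast hkn.le) hZ hlam0.le (by linarith) hp0 hp1
    (by rw [hp, ← hb, div_mul_cancel₀ _ (by linarith)])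
  rw [← ha, ← hb] at hle
  exact ⟨H, hH, hle.trans (weight_div_le a.cast_nonneg b.cast_nonneg hp0 (by linarith)
    (by linarith) hlam2)⟩
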